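/- Let $N=(G,S,T,c)$ be a network: $G=(V,E)$ is a finite directed graph without loops and multiple edges, with $n=|V|$ and $m=|E|$; $S,T\subseteq V$ are disjoint sets (sources and sinks) such that no edge enters a vertex of $S$ and no edge leaves a vertex of $T$; and $c:E\to\mathbb R_+$ gives the capacities. For each internal vertex $v\in V\setminus(S\cup T)$ let strict linear orders be given on the set $\delta^{\rm in}(v)$ of edges entering $v$ and on the set $\delta^{\rm out}(v)$ of edges leaving $v$ (earlier edges are preferred). For $f:E\to\mathbb R$ put $$\mathrm{excess}_f(v)=\sum_{e\in\delta^{\rm in}(v)}f(e)-\sum_{e\in\delta^{\rm out}(v)}f(e).$$ Given $\gamma:V\setminus(S\cup T)\to\mathbb R_+$, a $\gamma$-preflow is a function $f:E\to\mathbb R_+$ with $f(e)\le c(e)$ for all $e\in E$, with $\mathrm{excess}_f(v)\ge 0$ for all $v\in V\setminus S$, and with $0\le\mathrm{excess}_f(v)\le\gamma(v)$ for all internal $v$. It is called stable if for every directed path $P=(v_0,e_1,v_1,\dots,e_k,v_k)$ with $k\ge1$ (vertices and edges may repeat, and $v_0=v_k$ is allowed) such that $f(e_i)<c(e_i)$ for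 all $i$, at least one of the following holds: (a) $v_k$ is internal, and $f(e)=0$ for every $e\in\delta^{\rm in}(v_k)$ later than $e_k$; (b) $v_0$ is internal, $f(e)=0$ for every $e\in\delta^{\rm out}(v_0)$ later than $e_1$, and $\mathrm{excess}_f(v_0)=0$. **Proposition.** For every network $N$ and every $\gamma:V\setminus(S\cup T)\to\mathbb R_+$ a stable $\gamma$-preflow exists, and it can be found in time $O(nm)$. The time bound means: there are a single program for a random access machine and a constant $C$ such that, for all $n$, $m$, $N$ and $\gamma$, the program, given $N$ and $\gamma$, outputs a stable $\gamma$-preflow after at most $C(nm+1)$ steps. The machine has variables and arrays holding natural numbers (with increment, decrement, comparison, and use as array indices) and variables and arrays holding real numbers (with addition, subtraction, comparison), each elementary operation, array access, test and command counting at least one step. The input consists of $n$, $m$, the type (internal, source or sink) of each vertex, the ends and the capacity of each edge, the numbers $\gamma(v)$, and, for each vertex $v$, the sets $\delta^{\rm in}(v)$ and $\delta^{\rm out}(v)$ as doubly linked lists, in preference order if $v$ is internal and in arbitrary order otherwise. -/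

import Mathlib

namespace StableFlow

/-- A network `N = (G, S, T, c)` on a directed graph with vertex set `V` and edge set `E`, without
loops and multiple edges, together with the preference orders of the internal vertices.
`outLt e e'` means that the common tail of `e` and `e'` prefers `e` to `e'`, and `inLt e e'` means
that the common head of `e` and `e'` prefers `e` to `e'`; the values of these relations on other
pairs of edges, and at sources and sinks, are irrelevant. -/
structure Network (V E : Type*) where
  tail : E → V
  head : E → V
  loopless : ∀ e, tail e ≠ head e
  simple : ∀ e e', tail e = tail e' → head e = head e' → e = e'
  S : Set V
  T : Set V
  disjoint : Disjoint S T
  no_in_source : ∀ e, head e ∉ S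
  no_out_sink : ∀ e, tail e ∉ T
  c : E → ℝ
  c_nonneg : ∀ e, 0 ≤ c e
  outLt : E → E → Prop
  inLt : E → E → Prop
  out_order : ∀ v, v ∉ S → v ∉ T →
    IsStrictTotalOrder {e : E // tail e = v} (fun a b => outLt a.1 b.1)
  in_order : ∀ v, v ∉ S → v ∉ T →
    IsStrictTotalOrder {e : E // head e = v} (fun a b => inLt a.1 b.1)

namespace Network

variable {V E : Type*}

/-- Internal vertices are those that are neither sources nor sinks. -/
def Internal (N : Network V E) (v : V) : Prop := v ∉ N.S ∧ v ∉ N.T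

/-- `0 ≤ f ≤ c` on every edge. -/
def Feasible (N : Network V E) (f : E → ℝ) : Prop := ∀ e, 0 ≤ f e ∧ f e ≤ N.c e

open Classical in
/-- The total value of `f` on the edges entering `v` minus that on the edges leaving `v`. -/
noncomputable def excess [Fintype E] (N : Network V E) (f : E → ℝ) (v : V) : ℝ :=
  (∑ e with N.head e = v, f e) - ∑ e with N.tail e = v, f e

/-- A preflow is a feasible function with nonnegative excess at every vertex outside `S`. -/
def IsPreflow [Fintype E] (N : Network V E) (f : E → ℝ) : Prop :=
  N.Feasible f ∧ ∀ v, v ∉ N.S → 0 ≤ N.excess f v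

/-- A `γ`-preflow is a preflow with `0 ≤ excess ≤ γ` at every internal vertex. -/
def IsGammaPreflow [Fintype E] (N : Network V E) (γ : V → ℝ) (f : E → ℝ) : Prop :=
  N.IsPreflow f ∧ ∀ v, N.Internal v → 0 ≤ N.excess f v ∧ N.excess f v ≤ γ v

/-- A directed path `(v₀, e₁, v₁, …, eₖ, vₖ)` (not necessarily simple) is given by its list of edges;
the nontrivial ones, `k ≥ 1`, are those with a nonempty list. -/
def IsDirectedPath (N : Network V E) (P : List E) : Prop :=
  P.IsChain (fun e e' => N.head e = N.tail e')

/-- All edges of the path are unsaturated. -/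
def Unsaturated (N : Network V E) (f : E → ℝ) (P : List E) : Prop := ∀ e ∈ P, f e < N.c e

/-- A path with first edge `e₁` is dominated at its start `v₀`: this vertex is internal and every
edge leaving `v₀` later than `e₁` is free of `f`. -/
def DominatedAtStart (N : Network V E) (f : E → ℝ) (e₁ : E) : Prop :=
  N.Internal (N.tail e₁) ∧ ∀ e, N.tail e = N.tail e₁ → N.outLt e₁ e → f e = 0

/-- A path with last edge `eₖ` is dominated at its end `vₖ`: this vertex is internal and every
edge entering `vₖ` later than `eₖ` is free of `f`. -/
def DominatedAtEnd (N : Network V E) (f : E → ℝ) (eₖ : E) : Prop :=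
  N.Internal (N.head eₖ) ∧ ∀ e, N.head e = N.head eₖ → N.inLt eₖ e → f e = 0

/-- Strong domination at the start: domination and no excess at the start. -/
def StronglyDominatedAtStart [Fintype E] (N : Network V E) (f : E → ℝ) (e₁ : E) : Prop :=
  N.DominatedAtStart f e₁ ∧ N.excess f (N.tail e₁) = 0

/-- A stable `γ`-preflow: every nontrivial unsaturated directed path is dominated at its end or
strongly dominated at its start. -/
def IsStableGammaPreflow [Fintype E] (N : Network V E) (γ : V → ℝ) (f : E → ℝ) : Prop :=
  N.IsGammaPreflow γ f ∧
    ∀ (P : List E) (hP : P ≠ []), N.IsDirectedPath P → N.Unsaturated f P →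
      N.DominatedAtEnd f (P.getLast hP) ∨ N.StronglyDominatedAtStart f (P.head hP)

end Network

/-! ### The machine model

A random access machine with finitely many variables and (unbounded) arrays of two kinds: natural
numbers, used as indices, on which the only arithmetic is adding and subtracting one; and
real numbers, which can be added, subtracted and compared. There is no conversion between the two
kinds. Programs are structured (sequence, branching, loop), and running time counts every
operation, array access, test and command that is executed. As natural numbers change by at most
one per operation, a run of `t` steps only forms indices that exceed the input by `O(t)`. -/

/-- The contents of the memory; variables and arrays are named by natural numbers. -/
structure Memory where
  natVar : ℕ → ℕ
  natArr : ℕ → ℕ → ℕ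
  realVar : ℕ → ℝ
  realArr : ℕ → ℕ → ℝ

namespace Memory

def setNat (σ : Memory) (x k : ℕ) : Memory :=
  { σ with natVar := Function.update σ.natVar x k }

noncomputable def setReal (σ : Memory) (x : ℕ) (r : ℝ) : Memory :=
  { σ with realVar := Function.update σ.realVar x r }

def putNat (σ : Memory) (a i k : ℕ) : Memory :=
  { σ with natArr := Function.update σ.natArr a (Function.update (σ.natArr a) i k) }

noncomputable def putReal (σ : Memory) (a i : ℕ) (r : ℝ) : Memory :=
  { σ with realArr := Function.update σ.realArr a (Function.update (σ.realArr a) i r) }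

end Memory

inductive NatExpr where
  | const (k : ℕ)
  | var (x : ℕ)
  | get (a : ℕ) (i : NatExpr)
  | succ (i : NatExpr)
  | pred (i : NatExpr)

namespace NatExpr

def eval (σ : Memory) : NatExpr → ℕ
  | const k => k
  | var x => σ.natVar x
  | get a i => σ.natArr a (i.eval σ)
  | succ i => i.eval σ + 1
  | pred i => i.eval σ - 1

def cost : NatExpr → ℕ
  | const _ => 1
  | var _ => 1
  | get _ i => i.cost + 1
  | succ i => i.cost + 1
  | pred i => i.cost + 1

end NatExpr

inductive RealExpr where
  | zero
  | var (x : ℕ)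
  | get (a : ℕ) (i : NatExpr)
  | add (r s : RealExpr)
  | sub (r s : RealExpr)

namespace RealExpr

noncomputable def eval (σ : Memory) : RealExpr → ℝ
  | zero => 0
  | var x => σ.realVar x
  | get a i => σ.realArr a (i.eval σ)
  | add r s => r.eval σ + s.eval σ
  | sub r s => r.eval σ - s.eval σ

def cost : RealExpr → ℕ
  | zero => 1
  | var _ => 1
  | get _ i => i.cost + 1
  | add r s => r.cost + s.cost + 1
  | sub r s => r.cost + s.cost + 1

end RealExpr

inductive Test where
  | natEq (i j : NatExpr)
  | natLt (i j : NatExpr)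
  | realEq (r s : RealExpr)
  | realLt (r s : RealExpr)
  | neg (b : Test)
  | both (b b' : Test)

namespace Test

def holds (σ : Memory) : Test → Prop
  | natEq i j => i.eval σ = j.eval σ
  | natLt i j => i.eval σ < j.eval σ
  | realEq r s => r.eval σ = s.eval σ
  | realLt r s => r.eval σ < s.eval σ
  | neg b => ¬ b.holds σ
  | both b b' => b.holds σ ∧ b'.holds σ

def cost : Test → ℕ
  | natEq i j => i.cost + j.cost + 1
  | natLt i j => i.cost + j.cost + 1
  | realEq r s => r.cost + s.cost + 1
  | realLt r s => r.cost + s.cost + 1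
  | neg b => b.cost + 1
  | both b b' => b.cost + b'.cost + 1

end Test

/-- Programs. -/
inductive Program where
  | skip
  | setNat (x : ℕ) (i : NatExpr)
  | setReal (x : ℕ) (r : RealExpr)
  | putNat (a : ℕ) (i j : NatExpr)
  | putReal (a : ℕ) (i : NatExpr) (r : RealExpr)
  | seq (p q : Program)
  | branch (b : Test) (p q : Program)
  | loop (b : Test) (p : Program)

/-- `Runs p σ t σ'`: the program `p`, started with memory `σ`, halts after `t` steps with memory
`σ'`. -/
inductive Runs : Program → Memory → ℕ → Memory → Prop
  | skip (σ : Memory) : Runs .skip σ 1 σ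
  | setNat (x : ℕ) (i : NatExpr) (σ : Memory) :
      Runs (.setNat x i) σ (i.cost + 1) (σ.setNat x (i.eval σ))
  | setReal (x : ℕ) (r : RealExpr) (σ : Memory) :
      Runs (.setReal x r) σ (r.cost + 1) (σ.setReal x (r.eval σ))
  | putNat (a : ℕ) (i j : NatExpr) (σ : Memory) :
      Runs (.putNat a i j) σ (i.cost + j.cost + 1) (σ.putNat a (i.eval σ) (j.eval σ))
  | putReal (a : ℕ) (i : NatExpr) (r : RealExpr) (σ : Memory) :
      Runs (.putReal a i r) σ (i.cost + r.cost + 1) (σ.putReal a (i.eval σ) (r.eval σ))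
  | seq {p q : Program} {σ σ' σ'' : Memory} {t t' : ℕ} :
      Runs p σ t σ' → Runs q σ' t' σ'' → Runs (.seq p q) σ (t + t') σ''
  | branch_true {b : Test} {p q : Program} {σ σ' : Memory} {t : ℕ} :
      b.holds σ → Runs p σ t σ' → Runs (.branch b p q) σ (b.cost + 1 + t) σ'
  | branch_false {b : Test} {p q : Program} {σ σ' : Memory} {t : ℕ} :
      ¬ b.holds σ → Runs q σ t σ' → Runs (.branch b p q) σ (b.cost + 1 + t) σ'
  | loop_stop {b : Test} {p : Program} {σ : Memory} :
      ¬ b.holds σ → Runs (.loop b p) σ (b.cost + 1) σ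
  | loop_step {b : Test} {p : Program} {σ σ' σ'' : Memory} {t t' : ℕ} :
      b.holds σ → Runs p σ t σ' → Runs (.loop b p) σ' t' σ'' →
        Runs (.loop b p) σ (b.cost + 1 + t + t') σ''

/-! ### Representation of the input

The vertices are `0, …, n - 1` and the edges `0, …, m - 1`. The edges leaving and the edges entering
a vertex are given as doubly linked lists, from the most to the least preferred one (in an arbitrary
order at sources and sinks). The number `m` serves as the null pointer. -/

/-- A reference to an edge; the null pointer is `m`. -/
def edgeRef {m : ℕ} : Option (Fin m) → ℕ
  | none => m
  | some e => e

/-- The arrays `first`, `last` (indexed by vertices) and `next`, `prev` (indexed by edges) represent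
the lists `l v` as doubly linked lists. -/
def LinkedLists {n m : ℕ} (l : Fin n → List (Fin m)) (first last next prev : ℕ → ℕ) : Prop :=
  ∀ v : Fin n, first v = edgeRef (l v).head? ∧ last v = edgeRef (l v).getLast? ∧
    ∀ (i : ℕ) (hi : i < (l v).length),
      next ((l v)[i] : Fin m) = edgeRef (l v)[i + 1]? ∧
      prev ((l v)[i] : Fin m) = edgeRef (if i = 0 then none else (l v)[i - 1]?)

/-- `l v` lists the edges `e` with `endpt e = v`, each of them once, at internal vertices in the
order `lt`. -/
def ListsEdges {n m : ℕ} (N : Network (Fin n) (Fin m)) (endpt : Fin m → Fin n)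
    (lt : Fin m → Fin m → Prop) (l : Fin n → List (Fin m)) : Prop :=
  ∀ v, (l v).Nodup ∧ (∀ e, e ∈ l v ↔ endpt e = v) ∧ (N.Internal v → (l v).Pairwise lt)

/-- The memory `σ` holds the network `N` with the bounds `γ` as input. Nothing is assumed about the
other cells of the memory. -/
def HoldsInput {n m : ℕ} (N : Network (Fin n) (Fin m)) (γ : Fin n → ℝ) (σ : Memory) : Prop :=
  σ.natVar 0 = n ∧ σ.natVar 1 = m ∧
  -- types of the vertices: `0` internal, `1` source, `2` sink
  (∀ v : Fin n, (N.Internal v → σ.natArr 0 v = 0) ∧ (v ∈ N.S → σ.natArr 0 v = 1) ∧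
    (v ∈ N.T → σ.natArr 0 v = 2)) ∧
  (∀ e : Fin m, σ.natArr 1 e = N.tail e ∧ σ.natArr 2 e = N.head e) ∧
  (∃ l : Fin n → List (Fin m), ListsEdges N N.tail N.outLt l ∧
    LinkedLists l (σ.natArr 3) (σ.natArr 4) (σ.natArr 5) (σ.natArr 6)) ∧
  (∃ l : Fin n → List (Fin m), ListsEdges N N.head N.inLt l ∧
    LinkedLists l (σ.natArr 7) (σ.natArr 8) (σ.natArr 9) (σ.natArr 10)) ∧
  (∀ e : Fin m, σ.realArr 0 e = N.c e) ∧
  (∀ v : Fin n, N.Internal v → σ.realArr 1 v = γ v)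

/-- The function on the edges that the memory holds as output. -/
def output (m : ℕ) (σ : Memory) : Fin m → ℝ := fun e => σ.realArr 2 e

end StableFlow

namespace StableFlow

open Function

/-! ### Pushing surpluses -/

/-- A state of the algorithm: the current function `f`, the amounts `r` by which the edges may still
be increased, the surpluses `s` of the vertices, and the unprocessed parts of the lists of leaving
and (reversed) of entering edges. -/
structure State (n m : ℕ) where
  f : Fin m → ℝ
  r : Fin m → ℝ
  s : Fin n → ℝ
  out : Fin n → List (Fin m)
  inn : Fin n → List (Fin m)

variable {n m : ℕ}

theorem Network.excess_eq_sum (N : Network (Fin n) (Fin m)) (f : Fin m → ℝ) (v : Fin n) :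
    N.excess f v =
      ∑ e, ((if N.head e = v then f e else 0) - (if N.tail e = v then f e else 0)) := by
  classical
  unfold Network.excess
  rw [Finset.sum_filter, Finset.sum_filter, ← Finset.sum_sub_distrib]
  refine Finset.sum_congr rfl fun e _ => ?_
  congr

theorem Network.excess_update (N : Network (Fin n) (Fin m)) (f : Fin m → ℝ) (p : Fin m) (d : ℝ)
    (v : Fin n) :
    N.excess (update f p (f p + d)) v =
      N.excess f v + (if N.head p = v then d else 0) - (if N.tail p = v then d else 0) := by
  have key : N.excess (update f p (f p + d)) v - N.excess f v =
      ∑ e, if e = p then (if N.head p = v then d else 0) - (if N.tail p = v then d else 0)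
        else 0 := by
    rw [N.excess_eq_sum, N.excess_eq_sum, ← Finset.sum_sub_distrib]
    refine Finset.sum_congr rfl fun e _ => ?_
    by_cases h : e = p
    · subst h
      simp only [update_self, if_true]
      split_ifs <;> ring
    · simp [h]
  rw [Finset.sum_ite_eq' Finset.univ p] at key
  simp only [Finset.mem_univ, if_true] at key
  linarith

/-- The sorted lists of the edges that leave and enter the vertices. -/
structure Lists (N : Network (Fin n) (Fin m)) (lo li : Fin n → List (Fin m)) : Prop where
  out : ListsEdges N N.tail N.outLt lo
  inn : ListsEdges N N.head N.inLt li

namespace State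

/-- The conditions on a state that do not involve the surpluses. -/
structure Core (N : Network (Fin n) (Fin m)) (lo li : Fin n → List (Fin m)) (X : State n m) :
    Prop where
  f_nonneg : ∀ e, 0 ≤ X.f e
  r_nonneg : ∀ e, 0 ≤ X.r e
  le_cap : ∀ e, X.f e + X.r e ≤ N.c e
  out_suffix : ∀ v, X.out v <:+ lo v
  inn_suffix : ∀ v, X.inn v <:+ (li v).reverse
  -- The sum `f + r` falls below the capacity only by an action of the head. The conclusion
  -- persists: lists only shrink, and an edge with `f = r = 0` can be pushed in neither direction.
  closed : ∀ e, X.f e + X.r e < N.c e → N.Internal (N.head e) ∧ X.out (N.head e) = [] ∧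
    ∀ e', N.head e' = N.head e → N.inLt e e' → X.f e' = 0 ∧ X.r e' = 0
  inn_passed : ∀ e, N.Internal (N.head e) → e ∉ X.inn (N.head e) → X.f e = 0 ∧ X.r e = 0
  out_passed : ∀ e, N.Internal (N.tail e) → e ∉ X.out (N.tail e) → X.r e = 0
  source : ∀ e, N.tail e ∈ N.S → X.r e = 0
  -- Leaving edges are used strictly in order, so those behind the current one have never carried
  -- flow.
  out_later : ∀ v p t, N.Internal v → X.out v = p :: t → ∀ e ∈ t, X.f e = 0

/-- The excess that a vertex may keep. -/
noncomputable def threshold (γ : Fin n → ℝ) (X : State n m) (v : Fin n) : ℝ :=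
  if X.out v = [] then γ v else 0

/-- The surpluses are the excesses beyond the thresholds. -/
def Balanced (N : Network (Fin n) (Fin m)) (γ : Fin n → ℝ) (X : State n m) : Prop :=
  ∀ v, N.Internal v → N.excess X.f v = X.s v + X.threshold γ v ∧ 0 ≤ N.excess X.f v

def Active (N : Network (Fin n) (Fin m)) (X : State n m) (v : Fin n) : Prop :=
  N.Internal v ∧ 0 < X.s v

/-- It depends on the lists alone and so stays fixed while amounts are pushed. The value `u` for two
empty lists is a placeholder that `Ready` excludes. -/
def nxt (N : Network (Fin n) (Fin m)) (X : State n m) (u : Fin n) : Fin n :=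
  match X.out u, X.inn u with
  | p :: _, _ => N.head p
  | [], q :: _ => N.tail q
  | [], [] => u

/-- The amount that can be pushed from `u` along its current edge. -/
def res (X : State n m) (u : Fin n) : ℝ :=
  match X.out u, X.inn u with
  | p :: _, _ => X.r p
  | [], q :: _ => X.f q
  | [], [] => 0

/-- Push the amount `d` from `u` along its current edge, without changing the surpluses. -/
noncomputable def push (X : State n m) (u : Fin n) (d : ℝ) : State n m :=
  match X.out u, X.inn u with
  | p :: _, _ => { X with f := update X.f p (X.f p + d), r := update X.r p (X.r p - d) }
  | [], q :: _ => { X with f := update X.f q (X.f q - d) }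
  | [], [] => X

/-- The current edge of `u` admits a push. -/
def Ready (N : Network (Fin n) (Fin m)) (X : State n m) (u : Fin n) : Prop :=
  N.Internal u ∧ ((∃ p t, X.out u = p :: t ∧ 0 < X.r p) ∨
    ∃ q t, X.out u = [] ∧ X.inn u = q :: t ∧ X.r q = 0 ∧ 0 < X.f q)

variable {N : Network (Fin n) (Fin m)} {lo li : Fin n → List (Fin m)} {γ : Fin n → ℝ}
  {X : State n m} {u w v : Fin n} {p q : Fin m} {t : List (Fin m)} {d : ℝ}

theorem nxt_of_out (h : X.out u = p :: t) : X.nxt N u = N.head p := by simp [nxt, h]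

theorem nxt_of_inn (h : X.out u = []) (h' : X.inn u = q :: t) : X.nxt N u = N.tail q := by
  simp [nxt, h, h']

theorem res_of_out (h : X.out u = p :: t) : X.res u = X.r p := by simp [res, h]

theorem res_of_inn (h : X.out u = []) (h' : X.inn u = q :: t) : X.res u = X.f q := by
  simp [res, h, h']

theorem push_of_out (h : X.out u = p :: t) :
    X.push u d = { X with f := update X.f p (X.f p + d), r := update X.r p (X.r p - d) } := by
  simp [push, h]

theorem push_of_inn (h : X.out u = []) (h' : X.inn u = q :: t) :
    X.push u d = { X with f := update X.f q (X.f q - d) } := by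
  simp [push, h, h']

@[simp] theorem push_out : (X.push u d).out = X.out := by unfold push; split <;> rfl

@[simp] theorem push_inn : (X.push u d).inn = X.inn := by unfold push; split <;> rfl

@[simp] theorem push_s : (X.push u d).s = X.s := by unfold push; split <;> rfl

theorem nxt_congr {Y : State n m} (ho : Y.out = X.out) (hi : Y.inn = X.inn) :
    Y.nxt N = X.nxt N := by
  funext u; simp only [nxt, ho, hi]

theorem Ready.res_pos (h : X.Ready N u) : 0 < X.res u := by
  obtain ⟨-, ⟨p, t, h, hp⟩ | ⟨q, t, h, h', hr, hf⟩⟩ := h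
  · rwa [res_of_out h]
  · rwa [res_of_inn h h']

/-! ### Effect of a single push on the invariants -/

namespace Core

theorem tail_eq (hL : Lists N lo li) (hX : X.Core N lo li) (h : p ∈ X.out u) : N.tail p = u :=
  ((hL.out u).2.1 p).1 ((hX.out_suffix u).subset h)

theorem head_eq (hL : Lists N lo li) (hX : X.Core N lo li) (h : q ∈ X.inn u) : N.head q = u :=
  ((hL.inn u).2.1 q).1 (List.mem_reverse.1 ((hX.inn_suffix u).subset h))

/-- The list `inn` is a suffix of the reversed preference list, so its first element is the least
preferred of those left. -/
theorem later_not_mem_inn (hL : Lists N lo li) (hX : X.Core N lo li) (hu : N.Internal u)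
    (h : X.inn u = q :: t) {e : Fin m} (he : N.head e = u) (hlt : N.inLt q e) :
    e ∉ X.inn u := by
  intro hmem
  have hq : N.head q = u := hX.head_eq hL (h ▸ List.mem_cons_self)
  have hord := N.in_order u hu.1 hu.2
  have hpw : (X.inn u).Pairwise (fun a b => N.inLt b a) :=
    (List.pairwise_reverse.2 ((hL.inn u).2.2 hu)).sublist (hX.inn_suffix u).sublist
  rw [h] at hmem hpw
  have hirr := hord.toIsStrictOrder.toIrrefl.irrefl
  have htr := hord.toIsStrictOrder.toIsTrans.trans
  rcases List.mem_cons.1 hmem with rfl | hmem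
  · exact hirr ⟨e, he⟩ hlt
  · exact hirr ⟨q, hq⟩ (htr ⟨q, hq⟩ ⟨e, he⟩ ⟨q, hq⟩ hlt ((List.pairwise_cons.1 hpw).1 e hmem))

theorem later_zero (hL : Lists N lo li) (hX : X.Core N lo li) (hu : N.Internal u)
    (h : X.inn u = q :: t) {e : Fin m} (he : N.head e = u) (hlt : N.inLt q e) :
    X.f e = 0 ∧ X.r e = 0 := by
  subst he
  exact hX.inn_passed e hu (hX.later_not_mem_inn hL hu h rfl hlt)

/-- A forward push preserves `f + r` on every edge, and it never touches an edge with `r = 0`. A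
push back lowers `f + r` on the current entering edge `q`; this is permitted by `closed`, since the
leaving edges are exhausted and all entering edges later than `q` were passed with `f = r = 0`. -/
theorem push (hL : Lists N lo li) (hX : X.Core N lo li) (hu : X.Ready N u) (hd : 0 ≤ d)
    (hd' : d ≤ X.res u) : (X.push u d).Core N lo li := by
  obtain ⟨hint, ⟨p, t, h, hp⟩ | ⟨q, t, h, h', hr, hf⟩⟩ := hu
  · rw [res_of_out h] at hd'
    rw [push_of_out h]
    have hpu : N.tail p = u := hX.tail_eq hL (h ▸ List.mem_cons_self)
    have hnd : (p :: t).Nodup := h ▸ (hL.out u).1.sublist (hX.out_suffix u).sublist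
    have hzero : ∀ e, X.f e = 0 ∧ X.r e = 0 →
        update X.f p (X.f p + d) e = 0 ∧ update X.r p (X.r p - d) e = 0 := by
      intro e he
      have : e ≠ p := by rintro rfl; linarith [he.2]
      simpa [this] using he
    have hr0 : ∀ e, X.r e = 0 → update X.r p (X.r p - d) e = 0 := by
      intro e he
      have : e ≠ p := by rintro rfl; linarith
      simpa [this] using he
    have hsum : ∀ e, update X.f p (X.f p + d) e + update X.r p (X.r p - d) e = X.f e + X.r e := by
      intro e
      by_cases he : e = p
      · subst he; simp
      · simp [he]
    refine ⟨fun e => ?_, fun e => ?_, fun e => ?_, hX.out_suffix, hX.inn_suffix, fun e => ?_,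
      fun e he he' => hzero e (hX.inn_passed e he he'),
      fun e he he' => hr0 e (hX.out_passed e he he'), fun e he => hr0 e (hX.source e he),
      fun v p' t' hv hvt e he => ?_⟩
    · by_cases he : e = p
      · subst he; simp only [update_self]; linarith [hX.f_nonneg e]
      · simpa [he] using hX.f_nonneg e
    · by_cases he : e = p
      · subst he; simp only [update_self]; linarith
      · simpa [he] using hX.r_nonneg e
    · simp only [hsum]; exact hX.le_cap e
    · simp only [hsum]
      intro he
      obtain ⟨h1, h2, h3⟩ := hX.closed e he
      exact ⟨h1, h2, fun e' he' hlt => hzero e' (h3 e' he' hlt)⟩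
    -- The only edge that gains flow is the first of its list, and lists have no duplicates.
    · have hep : e ≠ p := by
        rintro rfl
        have : N.tail e = v := hX.tail_eq hL (hvt ▸ List.mem_cons_of_mem _ he)
        have huv : u = v := hpu.symm.trans this
        subst huv
        have hvt : X.out u = p' :: t' := hvt
        rw [h] at hvt
        obtain ⟨-, rfl⟩ := List.cons.inj hvt
        exact (List.nodup_cons.1 hnd).1 he
      simpa [hep] using hX.out_later v p' t' hv hvt e he
  · rw [res_of_inn h h'] at hd'
    rw [push_of_inn h h']
    have hqu : N.head q = u := hX.head_eq hL (h' ▸ List.mem_cons_self)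
    have hzf : ∀ e, X.f e = 0 → update X.f q (X.f q - d) e = 0 := by
      intro e he
      have : e ≠ q := by rintro rfl; linarith
      simpa [this] using he
    have hle : ∀ e, update X.f q (X.f q - d) e ≤ X.f e := by
      intro e
      by_cases he : e = q
      · subst he; simp [hd]
      · simp [he]
    refine ⟨fun e => ?_, hX.r_nonneg, fun e => ?_, hX.out_suffix, hX.inn_suffix, fun e => ?_,
      fun e he he' => ?_, hX.out_passed, hX.source, fun v p' t' hv hvt e he => ?_⟩
    · by_cases he : e = q
      · subst he; simp only [update_self]; linarith
      · simpa [he] using hX.f_nonneg e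
    · have := hX.le_cap e
      have := hle e
      simp only; linarith
    · intro he
      by_cases heq : e = q
      · subst heq
        rw [hqu]
        refine ⟨hint, h, fun e' he' hlt => ?_⟩
        obtain ⟨h1, h2⟩ := hX.later_zero hL hint h' he' hlt
        exact ⟨hzf e' h1, h2⟩
      · simp only [update_of_ne heq] at he
        obtain ⟨h1, h2, h3⟩ := hX.closed e he
        exact ⟨h1, h2, fun e' he' hlt => ⟨hzf e' (h3 e' he' hlt).1, (h3 e' he' hlt).2⟩⟩
    · obtain ⟨h1, h2⟩ := hX.inn_passed e he he'
      exact ⟨hzf e h1, h2⟩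
    · exact hzf e (hX.out_later v p' t' hv hvt e he)

theorem excess_push (hL : Lists N lo li) (hX : X.Core N lo li) (hu : X.Ready N u) (v : Fin n) :
    N.excess (X.push u d).f v =
      N.excess X.f v + (if X.nxt N u = v then d else 0) - (if u = v then d else 0) := by
  obtain ⟨-, ⟨p, t, h, -⟩ | ⟨q, t, h, h', -, -⟩⟩ := hu
  · have hpu : N.tail p = u := hX.tail_eq hL (h ▸ List.mem_cons_self)
    rw [push_of_out h, nxt_of_out h, N.excess_update, hpu]
  · have hqu : N.head q = u := hX.head_eq hL (h' ▸ List.mem_cons_self)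
    rw [push_of_inn h h', nxt_of_inn h h']
    simp only [sub_eq_add_neg]
    rw [N.excess_update, hqu]
    split_ifs <;> ring

theorem nxt_ne (hL : Lists N lo li) (hX : X.Core N lo li) (hu : X.Ready N u) :
    X.nxt N u ≠ u := by
  obtain ⟨-, ⟨p, t, h, -⟩ | ⟨q, t, h, h', -, -⟩⟩ := hu
  · rw [nxt_of_out h, ← hX.tail_eq hL (u := u) (p := p) (h ▸ List.mem_cons_self)]
    exact (N.loopless p).symm
  · rw [nxt_of_inn h h']
    intro he
    exact N.loopless q (he.trans (hX.head_eq hL (u := u) (h' ▸ List.mem_cons_self)).symm)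

/-- A push at `u` does not affect the current edges of the other vertices. -/
theorem push_other (hL : Lists N lo li) (hX : X.Core N lo li) (hu : X.Ready N u)
    (hw : X.Ready N w) (hwu : w ≠ u) :
    (X.push u d).Ready N w ∧ (X.push u d).res w = X.res w := by
  obtain ⟨-, ⟨p, t, h, hp⟩ | ⟨q, t, h, h', hr, hf⟩⟩ := hu <;>
  obtain ⟨hiw, ⟨p', t', k, hp'⟩ | ⟨q', t', k, k', hr', hf'⟩⟩ := hw
  · have hne : p' ≠ p := by
      rintro rfl
      exact hwu ((hX.tail_eq hL (u := w) (k ▸ List.mem_cons_self)).symm.trans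
        (hX.tail_eq hL (u := u) (h ▸ List.mem_cons_self)))
    have k2 : (X.push u d).out w = p' :: t' := by simpa using k
    have hr2 : (X.push u d).r p' = X.r p' := by rw [push_of_out h]; simp [hne]
    exact ⟨⟨hiw, .inl ⟨p', t', k2, by rwa [hr2]⟩⟩, by rw [res_of_out k2, res_of_out k, hr2]⟩
  -- An edge cannot be pushed forward by its tail and back by its head: the one needs `r > 0`, the
  -- other `r = 0`. This is why an edge is closed before flow is returned on it.
  · have hne : q' ≠ p := by rintro rfl; linarith
    have k2 : (X.push u d).out w = [] := by simpa using k
    have k3 : (X.push u d).inn w = q' :: t' := by simpa using k'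
    have hr2 : (X.push u d).r q' = X.r q' := by rw [push_of_out h]; simp [hne]
    have hf2 : (X.push u d).f q' = X.f q' := by rw [push_of_out h]; simp [hne]
    exact ⟨⟨hiw, .inr ⟨q', t', k2, k3, by rwa [hr2], by rwa [hf2]⟩⟩,
      by rw [res_of_inn k2 k3, res_of_inn k k', hf2]⟩
  · have k2 : (X.push u d).out w = p' :: t' := by simpa using k
    have hr2 : (X.push u d).r p' = X.r p' := by rw [push_of_inn h h']
    exact ⟨⟨hiw, .inl ⟨p', t', k2, by rwa [hr2]⟩⟩, by rw [res_of_out k2, res_of_out k, hr2]⟩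
  · have hne : q' ≠ q := by
      rintro rfl
      exact hwu ((hX.head_eq hL (u := w) (k' ▸ List.mem_cons_self)).symm.trans
        (hX.head_eq hL (u := u) (h' ▸ List.mem_cons_self)))
    have k2 : (X.push u d).out w = [] := by simpa using k
    have k3 : (X.push u d).inn w = q' :: t' := by simpa using k'
    have hr2 : (X.push u d).r q' = X.r q' := by rw [push_of_inn h h']
    have hf2 : (X.push u d).f q' = X.f q' := by rw [push_of_inn h h']; simp [hne]
    exact ⟨⟨hiw, .inr ⟨q', t', k2, k3, by rwa [hr2], by rwa [hf2]⟩⟩,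
      by rw [res_of_inn k2 k3, res_of_inn k k', hf2]⟩

end Core

theorem Ready.push_self (hu : X.Ready N u) (hd : d < X.res u) : (X.push u d).Ready N u := by
  obtain ⟨hi, ⟨p, t, h, hp⟩ | ⟨q, t, h, h', hr, hf⟩⟩ := hu
  · rw [res_of_out h] at hd
    refine ⟨hi, .inl ⟨p, t, by simpa using h, ?_⟩⟩
    rw [push_of_out h]; simpa using hd
  · rw [res_of_inn h h'] at hd
    refine ⟨hi, .inr ⟨q, t, by simpa using h, by simpa using h', ?_, ?_⟩⟩
    · rw [push_of_inn h h']; exact hr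
    · rw [push_of_inn h h']; simpa using hd

/-- Without active vertices, the state yields a stable `γ`-preflow. -/
theorem Core.isStable (hL : Lists N lo li) (hX : X.Core N lo li) (hb : X.Balanced N γ)
    (ha : ∀ v, ¬ X.Active N v) (hγ : ∀ v, N.Internal v → 0 ≤ γ v) :
    N.IsStableGammaPreflow γ X.f := by
  have hs : ∀ v, N.Internal v → X.s v ≤ 0 := fun v hv => not_lt.1 fun h => ha v ⟨hv, h⟩
  refine ⟨⟨⟨fun e => ⟨hX.f_nonneg e, ?_⟩, fun v hv => ?_⟩, fun v hv => ⟨(hb v hv).2, ?_⟩⟩, ?_⟩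
  · linarith [hX.r_nonneg e, hX.le_cap e]
  · by_cases hT : v ∈ N.T
    · rw [N.excess_eq_sum]
      refine Finset.sum_nonneg fun e _ => ?_
      have : N.tail e ≠ v := fun h => N.no_out_sink e (h ▸ hT)
      rw [if_neg this, sub_zero]
      split_ifs
      exacts [hX.f_nonneg e, le_rfl]
    · exact (hb v ⟨hv, hT⟩).2
  · have h1 := (hb v hv).1
    have h2 := hs v hv
    have h3 := hγ v hv
    unfold threshold at h1
    split_ifs at h1 <;> linarith
  -- an unsaturated edge is closed, or its tail still waits for more
  have key : ∀ e, X.f e < N.c e → ¬ X.f e + X.r e < N.c e →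
      N.StronglyDominatedAtStart X.f e ∧ X.out (N.tail e) ≠ [] := by
    intro e he hnc
    have hr : X.r e ≠ 0 := fun h => hnc (by rwa [h, add_zero])
    have hint : N.Internal (N.tail e) :=
      ⟨fun h => hr (hX.source e h), N.no_out_sink e⟩
    -- An edge leaves the list of its tail only with `r = 0`.
    have hmem : e ∈ X.out (N.tail e) := by
      by_contra h
      exact hr (hX.out_passed e hint h)
    have hne : X.out (N.tail e) ≠ [] := List.ne_nil_of_mem hmem
    refine ⟨⟨⟨hint, fun e' he' hlt => ?_⟩, ?_⟩, hne⟩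
    · obtain ⟨p, t, hpt⟩ := List.exists_cons_of_ne_nil hne
      refine hX.out_later _ p t hint hpt e' ?_
      have hord := N.out_order _ hint.1 hint.2
      have hirr := hord.toIsStrictOrder.toIrrefl.irrefl
      have htr := hord.toIsStrictOrder.toIsTrans.trans
      have hpw := (hL.out (N.tail e)).2.2 hint
      obtain ⟨l, hl⟩ := hX.out_suffix (N.tail e)
      rw [← hl, hpt] at hpw
      have he'm : e' ∈ l ++ p :: t := by
        rw [← hpt, hl]; exact ((hL.out _).2.1 e').2 he'
      rw [hpt] at hmem
      rw [List.pairwise_append, List.pairwise_cons] at hpw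
      obtain ⟨-, ⟨hpw1, -⟩, hpw2⟩ := hpw
      rcases List.mem_append.1 he'm with h1 | h1
      · exact absurd (htr ⟨e, rfl⟩ ⟨e', he'⟩ ⟨e, rfl⟩ hlt (hpw2 e' h1 e hmem)) (hirr ⟨e, rfl⟩)
      · rcases List.mem_cons.1 h1 with rfl | h1
        · rcases List.mem_cons.1 hmem with h2 | h2
          · subst h2
            exact absurd hlt (hirr ⟨e, rfl⟩)
          · exact absurd (htr ⟨e, rfl⟩ ⟨e', he'⟩ ⟨e, rfl⟩ hlt (hpw1 e h2)) (hirr ⟨e, rfl⟩)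
        · exact h1
    · have h1 := (hb _ hint).1
      have h2 := hs _ hint
      have h3 := (hb _ hint).2
      rw [threshold, if_neg hne] at h1
      linarith
  -- Backwards along the path: a nonempty list at the tail of an edge prevents the preceding edge
  -- from being closed, so `key` applies to that one as well.
  have main : ∀ (P : List (Fin m)) (hP : P ≠ []), N.IsDirectedPath P → N.Unsaturated X.f P →
      ¬ X.f (P.getLast hP) + X.r (P.getLast hP) < N.c (P.getLast hP) →
      N.StronglyDominatedAtStart X.f (P.head hP) ∧ X.out (N.tail (P.head hP)) ≠ [] := by
    intro P
    induction P with
    | nil => intro hP; exact absurd rfl hP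
    | cons e P ih =>
      intro hP hdir hun hd
      rcases P with _ | ⟨e', P⟩
      · exact key e (hun e (by simp)) (by simpa using hd)
      · have h1 := ih (by simp) (List.isChain_cons_cons.1 hdir).2
          (fun a ha => hun a (List.mem_cons_of_mem _ ha)) (by simpa using hd)
        have h2 : N.head e = N.tail e' := (List.isChain_cons_cons.1 hdir).1
        refine key e (hun e (by simp)) fun hc => ?_
        have h4 := (hX.closed e hc).2.1
        rw [h2] at h4
        exact h1.2 h4
  intro P hP hdir hun
  by_cases hc : X.f (P.getLast hP) + X.r (P.getLast hP) < N.c (P.getLast hP)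
  · obtain ⟨h1, -, h3⟩ := hX.closed _ hc
    exact .inl ⟨h1, fun e' he' hlt => (h3 e' he' hlt).1⟩
  · exact .inr (main P hP hdir hun hc).1

/-! ### The potential -/

open Classical in
/-- The number of events that may still happen on an edge: its saturation or closing, and its
becoming free of flow for good. -/
noncomputable def edgePotential (X : State n m) (e : Fin m) : ℕ :=
  (if 0 < X.r e then 1 else 0) + (if 0 < X.r e ∨ 0 < X.f e then 1 else 0)

open Classical in
noncomputable def activeSet (N : Network (Fin n) (Fin m)) (X : State n m) : Finset (Fin n) :=
  Finset.univ.filter (X.Active N)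

theorem mem_activeSet : v ∈ X.activeSet N ↔ X.Active N v := by simp [activeSet]

theorem activeSet_congr {Y : State n m} (h : Y.s = X.s) : Y.activeSet N = X.activeSet N := by
  ext v; simp only [mem_activeSet, Active, h]

/-- A bound on the number of events that are still to come. -/
noncomputable def potential (N : Network (Fin n) (Fin m)) (X : State n m) : ℕ :=
  ∑ v, (X.out v).length + ∑ v, (X.inn v).length + 2 * ∑ e, X.edgePotential e +
    (X.activeSet N).card

theorem edgePotential_le {Y : State n m} {e : Fin m} (hr : 0 < Y.r e → 0 < X.r e)
    (hf : 0 < Y.f e → 0 < X.r e ∨ 0 < X.f e) : Y.edgePotential e ≤ X.edgePotential e := by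
  unfold edgePotential
  split_ifs <;> first | omega | tauto

theorem edgePotential_lt {Y : State n m} {e : Fin m} (hr : Y.r e = 0)
    (h : 0 < X.r e ∨ (Y.f e = 0 ∧ 0 < X.f e)) :
    Y.edgePotential e < X.edgePotential e := by
  unfold edgePotential
  simp only [hr, lt_irrefl, if_false, false_or, zero_add]
  rcases h with h | ⟨h, h'⟩
  · simp only [h, if_true, true_or]
    split_ifs <;> omega
  · simp [h, h']

/-- A forward push may create flow on the edge, but `r > 0` already counts for both terms of its
potential. A push back happens only with `r = 0`, and it can only remove flow. -/
theorem edgePotential_push (hu : X.Ready N u) (hd' : d ≤ X.res u) :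
    (∀ e, (X.push u d).edgePotential e ≤ X.edgePotential e) ∧
      (d = X.res u → ∃ e, (X.push u d).edgePotential e < X.edgePotential e) := by
  obtain ⟨hint, ⟨p, t, h, hp⟩ | ⟨q, t, h, h', hr, hf⟩⟩ := hu
  · rw [res_of_out h] at hd' ⊢
    rw [push_of_out h]
    refine ⟨fun e => ?_, fun hdr => ⟨p, edgePotential_lt ?_ (.inl hp)⟩⟩
    · by_cases he : e = p
      · subst he
        exact edgePotential_le (fun _ => hp) (fun _ => .inl hp)
      · exact edgePotential_le (by simp [he]) (by simp [he]; tauto)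
    · simp [hdr]
  · rw [res_of_inn h h'] at hd' ⊢
    rw [push_of_inn h h']
    refine ⟨fun e => ?_, fun hdr => ⟨q, edgePotential_lt hr (.inr ⟨?_, hf⟩)⟩⟩
    · by_cases he : e = q
      · subst he
        exact edgePotential_le (by simp) (fun _ => .inr hf)
      · exact edgePotential_le (by simp) (by simp [he]; tauto)
    · simp [hdr]

theorem sum_edgePotential_push (hu : X.Ready N u) (hd' : d ≤ X.res u) :
    ∑ e, (X.push u d).edgePotential e ≤ ∑ e, X.edgePotential e ∧
      (d = X.res u → ∑ e, (X.push u d).edgePotential e < ∑ e, X.edgePotential e) := by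
  obtain ⟨h1, h2⟩ := edgePotential_push hu hd'
  refine ⟨Finset.sum_le_sum fun e _ => h1 e, fun h => ?_⟩
  obtain ⟨e, he⟩ := h2 h
  exact Finset.sum_lt_sum (fun e _ => h1 e) ⟨e, Finset.mem_univ e, he⟩

theorem sum_length_update {l : Fin n → List (Fin m)} (h : l u = p :: t) :
    ∑ v, (update l u t v).length < ∑ v, (l v).length := by
  refine Finset.sum_lt_sum (fun v _ => ?_) ⟨u, Finset.mem_univ u, by simp [h]⟩
  by_cases hv : v = u
  · subst hv; simp [h]
  · simp [hv]

/-- The invariants of the algorithm. -/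
structure Valid (N : Network (Fin n) (Fin m)) (γ : Fin n → ℝ) (lo li : Fin n → List (Fin m))
    (X : State n m) : Prop where
  core : X.Core N lo li
  balanced : X.Balanced N γ

theorem Core.congr_s (hX : X.Core N lo li) (s : Fin n → ℝ) : ({ X with s := s }).Core N lo li :=
  ⟨hX.f_nonneg, hX.r_nonneg, hX.le_cap, hX.out_suffix, hX.inn_suffix, hX.closed, hX.inn_passed,
    hX.out_passed, hX.source, hX.out_later⟩

theorem activeSet_subset {Y : State n m} (h : ∀ v, v ≠ u → Y.s v ≤ X.s v)
    (hu : ¬ X.Active N u → ¬ Y.Active N u) : Y.activeSet N ⊆ X.activeSet N := by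
  intro v hv
  simp only [activeSet, Finset.mem_filter, Finset.mem_univ, true_and] at hv ⊢
  by_cases h' : v = u
  · subst h'
    by_contra hn
    exact hu hn hv
  · exact ⟨hv.1, hv.2.trans_le (h v h')⟩

/-! ### Passing to the next edge of a list, and closing an edge -/

/-- Remove the first edge `p` from the list of edges leaving `u`, of which `t` remains. -/
noncomputable def advanceOut (γ : Fin n → ℝ) (X : State n m) (u : Fin n) (t : List (Fin m)) :
    State n m :=
  { X with
    out := update X.out u t
    s := if t = [] then update X.s u (X.s u - γ u) else X.s }

/-- When the last leaving edge is passed, the threshold of `u` jumps from `0` to `γ u` and the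
surplus drops by the same amount, possibly below zero. As `γ u` is nonnegative, no vertex becomes
active. -/
theorem Valid.advanceOut (hγ : ∀ v, N.Internal v → 0 ≤ γ v)
    (hX : X.Valid N γ lo li) (hu : N.Internal u) (h : X.out u = p :: t) (hr : X.r p = 0) :
    (X.advanceOut γ u t).Valid N γ lo li ∧
      (X.advanceOut γ u t).potential N < X.potential N := by
  have hc := hX.core
  refine ⟨⟨⟨hc.f_nonneg, hc.r_nonneg, hc.le_cap, fun v => ?_, hc.inn_suffix, fun e he => ?_,
    hc.inn_passed, fun e he he' => ?_, hc.source, fun v p' t' hv hvt e he => ?_⟩,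
    fun v hv => ?_⟩, ?_⟩
  · by_cases hv : v = u
    · subst hv
      simp only [State.advanceOut, update_self]
      exact ((List.suffix_cons p t).trans (h ▸ List.suffix_rfl)).trans (hc.out_suffix v)
    · simpa [State.advanceOut, hv] using hc.out_suffix v
  · obtain ⟨h1, h2, h3⟩ := hc.closed e he
    refine ⟨h1, ?_, h3⟩
    have : N.head e ≠ u := by rintro rfl; simp [h] at h2
    simpa [State.advanceOut, this] using h2
  · by_cases hv : N.tail e = u
    · subst hv
      simp only [State.advanceOut, update_self] at he'
      by_cases hep : e = p
      · subst hep; exact hr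
      · exact hc.out_passed e he (by simp [h, hep, he'])
    · exact hc.out_passed e he (by simpa [State.advanceOut, hv] using he')
  · by_cases hvu : v = u
    · subst hvu
      simp only [State.advanceOut, update_self] at hvt
      exact hc.out_later v p t hv h e (hvt ▸ List.mem_cons_of_mem _ he)
    · exact hc.out_later v p' t' hv (by simpa [State.advanceOut, hvu] using hvt) e he
  · refine ⟨?_, (hX.balanced v hv).2⟩
    have h1 := (hX.balanced v hv).1
    simp only [State.advanceOut, threshold] at h1 ⊢
    rw [h1]
    by_cases hvu : v = u
    · subst hvu
      by_cases ht : t = []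
      · simp [ht, h]
      · simp [ht, h]
    · by_cases ht : t = [] <;> simp [ht, hvu]
  · have h1 := sum_length_update h
    have h2 : ((X.advanceOut γ u t).activeSet N).card ≤ (X.activeSet N).card := by
      refine Finset.card_le_card (activeSet_subset (u := u) (fun v hv => ?_) fun hn ha => hn ?_)
      · by_cases ht : t = [] <;> simp [State.advanceOut, ht, hv]
      · refine ⟨hu, ha.2.trans_le ?_⟩
        by_cases ht : t = []
        · simp [State.advanceOut, ht, hγ u hu]
        · simp [State.advanceOut, ht]
    have h3 : ∑ e, (X.advanceOut γ u t).edgePotential e = ∑ e, X.edgePotential e := rfl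
    unfold potential
    rw [h3]
    simp only [State.advanceOut] at h1 h2 ⊢
    omega

/-- Do not admit any further increase of `q`. -/
noncomputable def close (X : State n m) (q : Fin m) : State n m :=
  { X with r := update X.r q 0 }

/-- Lowering `r q` may put `q` under the condition `closed`, which holds for it because its head `u`
has no leaving edges left and has passed all entering edges later than `q`. -/
theorem Valid.close (hL : Lists N lo li) (hX : X.Valid N γ lo li) (hu : N.Internal u)
    (h : X.out u = []) (h' : X.inn u = q :: t) (hr : X.r q ≠ 0) :
    (X.close q).Valid N γ lo li ∧ (X.close q).potential N < X.potential N := by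
  have hc := hX.core
  have hqu : N.head q = u := hc.head_eq hL (h' ▸ List.mem_cons_self)
  have hle : ∀ e, update X.r q 0 e ≤ X.r e := by
    intro e
    by_cases he : e = q
    · subst he; simpa using hc.r_nonneg e
    · simp [he]
  have hz : ∀ e, X.r e = 0 → update X.r q 0 e = 0 := by
    intro e h0
    by_cases he : e = q
    · simp [he]
    · simpa [he] using h0
  have hpos : 0 < X.r q := lt_of_le_of_ne (hc.r_nonneg q) hr.symm
  refine ⟨⟨⟨hc.f_nonneg, fun e => ?_, fun e => ?_, hc.out_suffix, hc.inn_suffix, fun e he => ?_,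
    fun e he he' => ?_, fun e he he' => hz e (hc.out_passed e he he'),
    fun e he => hz e (hc.source e he), hc.out_later⟩, hX.balanced⟩, ?_⟩
  · by_cases he : e = q
    · simp [State.close, he]
    · simpa [State.close, he] using hc.r_nonneg e
  · have h1 := hc.le_cap e
    have h2 := hle e
    simp only [State.close]; linarith
  · by_cases heq : e = q
    · subst heq
      rw [hqu]
      refine ⟨hu, h, fun e' he' hlt => ?_⟩
      obtain ⟨h1, h2⟩ := hc.later_zero hL hu h' he' hlt
      exact ⟨h1, hz e' h2⟩
    · simp only [State.close, update_of_ne heq] at he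
      obtain ⟨h1, h2, h3⟩ := hc.closed e he
      exact ⟨h1, h2, fun e' he' hlt => ⟨(h3 e' he' hlt).1, hz e' (h3 e' he' hlt).2⟩⟩
  · obtain ⟨h1, h2⟩ := hc.inn_passed e he he'
    exact ⟨h1, hz e h2⟩
  · have h1 : ∑ e, (X.close q).edgePotential e < ∑ e, X.edgePotential e := by
      refine Finset.sum_lt_sum (fun e _ => edgePotential_le ?_ ?_) ⟨q, Finset.mem_univ q,
        edgePotential_lt (by simp [State.close]) (.inl hpos)⟩
      · exact fun h0 => h0.trans_le (hle e)
      · exact fun h0 => .inr h0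
    have h2 : (X.close q).activeSet N = X.activeSet N := rfl
    unfold potential
    rw [h2]
    simp only [State.close] at h1 ⊢
    omega

/-- Replace the list of edges entering `u` by `t`. -/
noncomputable def advanceInn (X : State n m) (u : Fin n) (t : List (Fin m)) : State n m :=
  { X with inn := update X.inn u t }

theorem Valid.advanceInn (hX : X.Valid N γ lo li) (h' : X.inn u = q :: t)
    (hr : X.r q = 0) (hf : X.f q = 0) :
    (X.advanceInn u t).Valid N γ lo li ∧ (X.advanceInn u t).potential N < X.potential N := by
  have hc := hX.core
  refine ⟨⟨⟨hc.f_nonneg, hc.r_nonneg, hc.le_cap, hc.out_suffix, fun v => ?_, hc.closed,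
    fun e he he' => ?_, hc.out_passed, hc.source, hc.out_later⟩, hX.balanced⟩, ?_⟩
  · by_cases hv : v = u
    · subst hv
      simp only [State.advanceInn, update_self]
      exact ((List.suffix_cons q t).trans (h' ▸ List.suffix_rfl)).trans (hc.inn_suffix v)
    · simpa [State.advanceInn, hv] using hc.inn_suffix v
  · by_cases hv : N.head e = u
    · subst hv
      simp only [State.advanceInn, update_self] at he'
      by_cases hep : e = q
      · subst hep; exact ⟨hf, hr⟩
      · exact hc.inn_passed e he (by simp [h', hep, he'])
    · exact hc.inn_passed e he (by simpa [State.advanceInn, hv] using he')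
  · have h1 := sum_length_update h'
    have h2 : (X.advanceInn u t).activeSet N = X.activeSet N := rfl
    have h3 : ∑ e, (X.advanceInn u t).edgePotential e = ∑ e, X.edgePotential e := rfl
    unfold potential
    rw [h2, h3]
    simp only [State.advanceInn] at h1 ⊢
    omega

/-- With both lists exhausted, all entering edges would be empty and the excess at most zero,
whereas an active vertex without leaving edges left has excess above `γ u`. -/
theorem Valid.exists_inn (hX : X.Valid N γ lo li) (hγ : ∀ v, N.Internal v → 0 ≤ γ v)
    (hu : X.Active N u) (h : X.out u = []) : ∃ q t, X.inn u = q :: t := by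
  refine List.exists_cons_of_ne_nil fun hi => ?_
  have h1 := (hX.balanced u hu.1).1
  rw [threshold, if_pos h] at h1
  have h2 : N.excess X.f u ≤ 0 := by
    rw [N.excess_eq_sum]
    refine Finset.sum_nonpos fun e _ => ?_
    have h3 : N.head e = u → X.f e = 0 := fun he => by
      subst he
      exact (hX.core.inn_passed e hu.1 (by simp [hi])).1
    have h4 := hX.core.f_nonneg e
    split_ifs with h5 h6 h6
    · exact absurd (h5.trans h6.symm) (N.loopless e).symm
    · rw [h3 h5]; simp
    · linarith
    · simp
  have := hu.2
  have := hγ u hu.1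
  linarith

/-! ### Pushing a surplus -/

/-- Push the amount `d` of the surplus of `u` along its current edge. -/
noncomputable def send (N : Network (Fin n) (Fin m)) (X : State n m) (u : Fin n) (d : ℝ) :
    State n m :=
  { X.push u d with
    s := update (update X.s u (X.s u - d)) (X.nxt N u) (X.s (X.nxt N u) + d) }

theorem send_nxt : (X.send N u d).nxt N = X.nxt N := by
  refine nxt_congr ?_ ?_ <;> simp [send]

theorem Valid.send (hL : Lists N lo li) (hγ : ∀ v, N.Internal v → 0 ≤ γ v)
    (hX : X.Valid N γ lo li) (hu : X.Ready N u) (hd : 0 ≤ d) (hd' : d ≤ X.res u)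
    (hs : d ≤ X.s u) : (X.send N u d).Valid N γ lo li := by
  refine ⟨(hX.core.push hL hu hd hd').congr_s _, fun v hv => ?_⟩
  have h1 := hX.core.excess_push hL hu (d := d) v
  have h2 : N.excess (X.send N u d).f v = N.excess (X.push u d).f v := rfl
  have h3 := hX.balanced v hv
  have h4 : (X.send N u d).threshold γ v = X.threshold γ v := by
    simp [threshold, State.send]
  have h6 : 0 ≤ X.threshold γ v := by
    unfold threshold
    split_ifs
    exacts [hγ v hv, le_rfl]
  rw [h2, h4, h1]
  have hne := hX.core.nxt_ne hL hu
  simp only [State.send]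
  by_cases hvu : v = u
  · subst hvu
    simp only [hne, if_false, if_true, update_of_ne hne.symm, update_self]
    constructor <;> linarith
  · simp only [Ne.symm hvu, if_false]
    by_cases hvw : v = X.nxt N u
    · subst hvw
      simp only [if_true, update_self]
      constructor <;> linarith
    · simp only [Ne.symm hvw, if_false, update_of_ne hvw, update_of_ne hvu]
      constructor <;> linarith

/-- Sending the whole surplus deactivates `u`, which compensates for a possible activation of the
receiver. There is a net gain if the receiver ends up inactive, for instance if it is a terminal. -/
theorem potential_send_full (hu : X.Ready N u)
    (ha : X.Active N u) (hne : X.nxt N u ≠ u) (hd' : X.s u ≤ X.res u) :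
    (X.send N u (X.s u)).potential N ≤ X.potential N ∧
      (¬ (X.send N u (X.s u)).Active N (X.nxt N u) →
        (X.send N u (X.s u)).potential N < X.potential N) := by
  classical
  have h1 := (sum_edgePotential_push hu hd').1
  have hmem : u ∈ X.activeSet N := mem_activeSet.2 ha
  have hcard := Finset.card_erase_add_one hmem
  have hsub : ∀ v ∈ (X.send N u (X.s u)).activeSet N,
      v ≠ X.nxt N u → v ∈ (X.activeSet N).erase u := by
    intro v hv hvw
    have hv' := (mem_activeSet.1 hv).2
    simp only [State.send, update_of_ne hvw] at hv'
    have hvu : v ≠ u := by rintro rfl; simp at hv'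
    rw [update_of_ne hvu] at hv'
    exact Finset.mem_erase.2 ⟨hvu, mem_activeSet.2 ⟨(mem_activeSet.1 hv).1, hv'⟩⟩
  have h2 : (X.send N u (X.s u)).potential N = ∑ v, (X.out v).length + ∑ v, (X.inn v).length +
      2 * ∑ e, (X.push u (X.s u)).edgePotential e + ((X.send N u (X.s u)).activeSet N).card := by
    simp only [potential, State.send, push_out, push_inn]
    rfl
  rw [h2, potential]
  constructor
  · have h3 : (X.send N u (X.s u)).activeSet N ⊆
        insert (X.nxt N u) ((X.activeSet N).erase u) := by
      intro v hv
      by_cases hvw : v = X.nxt N u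
      · simp [hvw]
      · exact Finset.mem_insert_of_mem (hsub v hv hvw)
    have h4 := (Finset.card_le_card h3).trans (Finset.card_insert_le _ _)
    omega
  · intro hna
    have h3 : (X.send N u (X.s u)).activeSet N ⊆ (X.activeSet N).erase u := by
      intro v hv
      refine hsub v hv ?_
      rintro rfl
      exact hna (mem_activeSet.1 hv)
    have h4 := Finset.card_le_card h3
    omega

/-- The receiver may become active while `u` stays so. The factor `2` before the edge potentials
makes the lost edge event outweigh this. -/
theorem potential_send_saturating (hu : X.Ready N u) :
    (X.send N u (X.res u)).potential N < X.potential N := by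
  classical
  have h1 := (sum_edgePotential_push hu le_rfl).2 rfl
  have h2 : (X.send N u (X.res u)).potential N = ∑ v, (X.out v).length +
      ∑ v, (X.inn v).length + 2 * ∑ e, (X.push u (X.res u)).edgePotential e +
      ((X.send N u (X.res u)).activeSet N).card := by
    simp only [potential, State.send, push_out, push_inn]
    rfl
  rw [h2, potential]
  have h3 : (X.send N u (X.res u)).activeSet N ⊆ insert (X.nxt N u) (X.activeSet N) := by
    intro v hv
    by_cases hvw : v = X.nxt N u
    · simp [hvw]
    · refine Finset.mem_insert_of_mem ?_
      have hv' := mem_activeSet.1 hv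
      refine mem_activeSet.2 ⟨hv'.1, hv'.2.trans_le ?_⟩
      simp only [State.send, update_of_ne hvw]
      by_cases hvu : v = u
      · subst hvu; simp [hu.res_pos.le]
      · simp [hvu]
  have h4 := (Finset.card_le_card h3).trans (Finset.card_insert_le _ _)
  omega

/-! ### Pushing round a cycle -/

/-- Push the amount `d` along the first `j` edges of the walk from `u`. -/
noncomputable def pushWalk (N : Network (Fin n) (Fin m)) (X : State n m) (u : Fin n) (d : ℝ) :
    ℕ → State n m
  | 0 => X
  | j + 1 => (pushWalk N X u d j).push ((X.nxt N)^[j] u) d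

@[simp] theorem pushWalk_out (j : ℕ) : (X.pushWalk N u d j).out = X.out := by
  induction j with
  | zero => rfl
  | succ j ih => simp [pushWalk, ih]

@[simp] theorem pushWalk_inn (j : ℕ) : (X.pushWalk N u d j).inn = X.inn := by
  induction j with
  | zero => rfl
  | succ j ih => simp [pushWalk, ih]

@[simp] theorem pushWalk_s (j : ℕ) : (X.pushWalk N u d j).s = X.s := by
  induction j with
  | zero => rfl
  | succ j ih => simp [pushWalk, ih]

@[simp] theorem pushWalk_nxt (j : ℕ) : (X.pushWalk N u d j).nxt N = X.nxt N :=
  nxt_congr (pushWalk_out j) (pushWalk_inn j)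

/-- Within one period the vertices of the walk are distinct, so by `push_other` the edges still
ahead keep their residual amounts. The changes of excess telescope to the two ends of the walk. -/
theorem pushWalk_spec (hL : Lists N lo li) (hX : X.Core N lo li)
    (hready : ∀ i, X.Ready N ((X.nxt N)^[i] u)) (hd : 0 ≤ d)
    (hres : ∀ i, d ≤ X.res ((X.nxt N)^[i] u)) (j : ℕ) (hj : j ≤ minimalPeriod (X.nxt N) u) :
    (X.pushWalk N u d j).Core N lo li ∧
    (∀ i, j ≤ i → i < minimalPeriod (X.nxt N) u →
      (X.pushWalk N u d j).Ready N ((X.nxt N)^[i] u) ∧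
      (X.pushWalk N u d j).res ((X.nxt N)^[i] u) = X.res ((X.nxt N)^[i] u)) ∧
    (∀ v, N.excess (X.pushWalk N u d j).f v = N.excess X.f v +
      (if (X.nxt N)^[j] u = v then d else 0) - (if u = v then d else 0)) ∧
    ∑ e, (X.pushWalk N u d j).edgePotential e ≤ ∑ e, X.edgePotential e ∧
    ((∃ i < j, d = X.res ((X.nxt N)^[i] u)) →
      ∑ e, (X.pushWalk N u d j).edgePotential e < ∑ e, X.edgePotential e) := by
  induction j with
  | zero => exact ⟨hX, fun i _ _ => ⟨hready i, rfl⟩, fun v => (add_sub_cancel_right _ _).symm, le_rfl,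
      by simp⟩
  | succ j ih =>
    obtain ⟨h1, h2, h3, h4, h5⟩ := ih (by omega)
    obtain ⟨hr, hre⟩ := h2 j le_rfl hj
    have hd' : d ≤ (X.pushWalk N u d j).res ((X.nxt N)^[j] u) := hre ▸ hres j
    have hpot := sum_edgePotential_push hr hd'
    refine ⟨h1.push hL hr hd hd', fun i hi hiL => ?_, fun v => ?_, hpot.1.trans h4, ?_⟩
    · have hne : (X.nxt N)^[i] u ≠ (X.nxt N)^[j] u := fun he => by
        have := iterate_injOn_Iio_minimalPeriod (f := X.nxt N) (x := u)
          (show i < _ from hiL) (show j < _ from hj) he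
        omega
      obtain ⟨g1, g2⟩ := h2 i (by omega) hiL
      obtain ⟨k1, k2⟩ := h1.push_other hL (d := d) hr g1 hne
      exact ⟨k1, k2.trans g2⟩
    · rw [pushWalk, h1.excess_push hL hr, h3, pushWalk_nxt, iterate_succ_apply']
      ring
    · rintro ⟨i, hi, hid⟩
      rcases Nat.lt_succ_iff_lt_or_eq.1 hi with hi | rfl
      · exact hpot.1.trans_lt (h5 ⟨i, hi, hid⟩)
      · exact (hpot.2 (hid.trans hre.symm)).trans_le h4

/-- Round a full period the two end terms cancel, so no excess changes and the surpluses stay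
correct; an edge attaining the minimum is exhausted. -/
theorem Valid.pushCycle (hL : Lists N lo li) (hX : X.Valid N γ lo li)
    (hready : ∀ i, X.Ready N ((X.nxt N)^[i] u)) (hd : 0 ≤ d)
    (hres : ∀ i, d ≤ X.res ((X.nxt N)^[i] u))
    (hmin : ∃ i < minimalPeriod (X.nxt N) u, d = X.res ((X.nxt N)^[i] u)) :
    (X.pushWalk N u d (minimalPeriod (X.nxt N) u)).Valid N γ lo li ∧
    (X.pushWalk N u d (minimalPeriod (X.nxt N) u)).potential N < X.potential N := by
  obtain ⟨h1, -, h3, -, h5⟩ := pushWalk_spec hL hX.core hready hd hres _ le_rfl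
  refine ⟨⟨h1, fun v hv => ?_⟩, ?_⟩
  · have h6 : N.excess (X.pushWalk N u d (minimalPeriod (X.nxt N) u)).f v = N.excess X.f v := by
      rw [h3, iterate_minimalPeriod]; ring
    rw [h6]
    have := hX.balanced v hv
    simpa [threshold] using this
  · have h6 := h5 hmin
    have h7 : (X.pushWalk N u d (minimalPeriod (X.nxt N) u)).activeSet N = X.activeSet N :=
      activeSet_congr (pushWalk_s _)
    unfold potential
    rw [h7]
    simp only [pushWalk_out, pushWalk_inn]
    omega

end State

/-! ### Orbits of a self-map of a finite set -/

theorem exists_iterate_eq (g : Fin n → Fin n) (v : Fin n) :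
    ∃ i j, i < j ∧ j ≤ n ∧ g^[i] v = g^[j] v := by
  have hnot : ¬ Set.InjOn (fun i => g^[i] v) (Finset.range (n + 1) : Set ℕ) := by
    intro h
    have h1 := Finset.card_le_card_of_injOn (t := Finset.univ) _ (by simp) h
    simp at h1
  simp only [Set.InjOn, not_forall] at hnot
  obtain ⟨i, hi, j, hj, hij, hne⟩ := hnot
  simp only [Finset.coe_range, Set.mem_Iio] at hi hj hij
  rcases Nat.lt_or_gt_of_ne hne with hlt | hlt
  · exact ⟨i, j, hlt, by omega, hij⟩
  · exact ⟨j, i, hlt, by omega, hij.symm⟩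

/-- After `n` steps in a set of `n` elements one is on a cycle. -/
theorem iterate_mem_periodicPts (g : Fin n → Fin n) (v : Fin n) : g^[n] v ∈ periodicPts g := by
  obtain ⟨i, j, hlt, hj, hij⟩ := exists_iterate_eq g v
  refine ⟨j - i, by omega, ?_⟩
  have h1 : g^[j - i] (g^[i] v) = g^[i] v := by
    rw [← iterate_add_apply, Nat.sub_add_cancel hlt.le, hij]
  have h2 : IsPeriodicPt g (j - i) (g^[n - i] (g^[i] v)) :=
    (show IsPeriodicPt g (j - i) (g^[i] v) from h1).apply_iterate _
  rwa [← iterate_add_apply, Nat.sub_add_cancel (by omega)] at h2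

/-- A coincidence of the iterates `i < j ≤ n` shortens any exponent `k ≥ n` by `j - i`. Thus a walk
that has been ready for its first `n` vertices is ready forever. -/
theorem exists_iterate_eq_lt (g : Fin n → Fin n) (v : Fin n) (k : ℕ) :
    ∃ j < n, g^[k] v = g^[j] v := by
  induction k using Nat.strong_induction_on with
  | _ k ih =>
    by_cases hk : k < n
    · exact ⟨k, hk, rfl⟩
    · obtain ⟨i, j, hlt, hj, hij⟩ := exists_iterate_eq g v
      obtain ⟨l, hl, h⟩ := ih (k - j + i) (by omega)
      refine ⟨l, hl, h ▸ ?_⟩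
      rw [iterate_add_apply, hij, ← iterate_add_apply, Nat.sub_add_cancel (by omega)]

theorem minimalPeriod_le (g : Fin n → Fin n) (v : Fin n) : minimalPeriod g v ≤ n := by
  have h := Finset.card_le_card_of_injOn (s := Finset.range (minimalPeriod g v))
    (t := Finset.univ) (fun i => g^[i] v) (by simp)
    (by simpa using iterate_injOn_Iio_minimalPeriod)
  simpa using h

/-! ### Running programs -/

namespace Memory

variable (σ : Memory) (x a i k : ℕ) (c : ℝ)

@[simp] theorem setNat_natVar : (σ.setNat x k).natVar = update σ.natVar x k := rfl
@[simp] theorem setNat_natArr : (σ.setNat x k).natArr = σ.natArr := rfl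
@[simp] theorem setNat_realVar : (σ.setNat x k).realVar = σ.realVar := rfl
@[simp] theorem setNat_realArr : (σ.setNat x k).realArr = σ.realArr := rfl
@[simp] theorem setReal_natVar : (σ.setReal x c).natVar = σ.natVar := rfl
@[simp] theorem setReal_natArr : (σ.setReal x c).natArr = σ.natArr := rfl
@[simp] theorem setReal_realVar : (σ.setReal x c).realVar = update σ.realVar x c := rfl
@[simp] theorem putNat_natVar : (σ.putNat a i k).natVar = σ.natVar := rfl
@[simp] theorem putNat_natArr :
    (σ.putNat a i k).natArr = update σ.natArr a (update (σ.natArr a) i k) := rfl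
@[simp] theorem putReal_natVar : (σ.putReal a i c).natVar = σ.natVar := rfl
@[simp] theorem putReal_natArr : (σ.putReal a i c).natArr = σ.natArr := rfl
@[simp] theorem putReal_realVar : (σ.putReal a i c).realVar = σ.realVar := rfl
@[simp] theorem putReal_realArr :
    (σ.putReal a i c).realArr = update σ.realArr a (update (σ.realArr a) i c) := rfl

end Memory

namespace Program

/-- Programs without loops. -/
def Straight : Program → Prop
  | seq p q => p.Straight ∧ q.Straight
  | branch _ p q => p.Straight ∧ q.Straight
  | loop _ _ => False
  | _ => True

/-- A bound on the running time of a program without loops. -/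
def maxCost : Program → ℕ
  | skip => 1
  | setNat _ i => i.cost + 1
  | setReal _ r => r.cost + 1
  | putNat _ i j => i.cost + j.cost + 1
  | putReal _ i r => i.cost + r.cost + 1
  | seq p q => p.maxCost + q.maxCost
  | branch b p q => b.cost + 1 + max p.maxCost q.maxCost
  | loop _ _ => 0

open Classical in
/-- The final memory of a program without loops. -/
noncomputable def post : Program → Memory → Memory
  | skip, σ => σ
  | setNat x i, σ => σ.setNat x (i.eval σ)
  | setReal x r, σ => σ.setReal x (r.eval σ)
  | putNat a i j, σ => σ.putNat a (i.eval σ) (j.eval σ)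
  | putReal a i r, σ => σ.putReal a (i.eval σ) (r.eval σ)
  | seq p q, σ => q.post (p.post σ)
  | branch b p q, σ => if b.holds σ then p.post σ else q.post σ
  | loop _ _, σ => σ

theorem post_branch_pos {b : Test} {p q : Program} {σ : Memory} (h : b.holds σ) :
    (branch b p q).post σ = p.post σ := if_pos h

theorem post_branch_neg {b : Test} {p q : Program} {σ : Memory} (h : ¬ b.holds σ) :
    (branch b p q).post σ = q.post σ := if_neg h

/-- `p`, started with `σ`, halts after at most `T` steps with a memory that satisfies `Q`. -/
def Reaches (p : Program) (σ : Memory) (T : ℕ) (Q : Memory → Prop) : Prop :=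
  ∃ t σ', Runs p σ t σ' ∧ t ≤ T ∧ Q σ'

variable {p q : Program} {b : Test} {σ : Memory} {T T' : ℕ} {Q R : Memory → Prop}

/-- This separates the two tasks for loop-free code: the effect is computed through `post`, and the
running time is bounded by the numeral `maxCost`, whatever the memory. -/
theorem Straight.reaches (hp : p.Straight) (hQ : Q (p.post σ)) : p.Reaches σ p.maxCost Q := by
  suffices h : ∃ t, Runs p σ t (p.post σ) ∧ t ≤ p.maxCost by
    obtain ⟨t, h1, h2⟩ := h
    exact ⟨t, _, h1, h2, hQ⟩
  clear hQ
  induction p generalizing σ with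
  | skip => exact ⟨_, .skip σ, le_rfl⟩
  | setNat x i => exact ⟨_, .setNat x i σ, le_rfl⟩
  | setReal x r => exact ⟨_, .setReal x r σ, le_rfl⟩
  | putNat a i j => exact ⟨_, .putNat a i j σ, le_rfl⟩
  | putReal a i r => exact ⟨_, .putReal a i r σ, le_rfl⟩
  | seq p q ihp ihq =>
    obtain ⟨t, h1, h2⟩ := ihp hp.1 (σ := σ)
    obtain ⟨t', h3, h4⟩ := ihq hp.2 (σ := p.post σ)
    exact ⟨_, .seq h1 h3, Nat.add_le_add h2 h4⟩
  | branch b p q ihp ihq =>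
    by_cases hb : b.holds σ
    · obtain ⟨t, h1, h2⟩ := ihp hp.1 (σ := σ)
      refine ⟨_, ?_, Nat.add_le_add_left (h2.trans (le_max_left _ _)) _⟩
      simp only [post, if_pos hb]
      exact .branch_true hb h1
    · obtain ⟨t, h1, h2⟩ := ihq hp.2 (σ := σ)
      refine ⟨_, ?_, Nat.add_le_add_left (h2.trans (le_max_right _ _)) _⟩
      simp only [post, if_neg hb]
      exact .branch_false hb h1
  | loop b p => exact hp.elim

theorem Reaches.mono (h : p.Reaches σ T Q) (hT : T ≤ T') (hQ : ∀ σ', Q σ' → R σ') :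
    p.Reaches σ T' R := by
  obtain ⟨t, σ', h1, h2, h3⟩ := h
  exact ⟨t, σ', h1, h2.trans hT, hQ _ h3⟩

theorem Reaches.seq (h : p.Reaches σ T Q) (h' : ∀ σ', Q σ' → q.Reaches σ' T' R) :
    (Program.seq p q).Reaches σ (T + T') R := by
  obtain ⟨t, σ', h1, h2, h3⟩ := h
  obtain ⟨t', σ'', h4, h5, h6⟩ := h' σ' h3
  exact ⟨_, _, .seq h1 h4, Nat.add_le_add h2 h5, h6⟩

theorem Reaches.branch (h : b.holds σ → p.Reaches σ T Q) (h' : ¬ b.holds σ → q.Reaches σ T Q) :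
    (Program.branch b p q).Reaches σ (b.cost + 1 + T) Q := by
  by_cases hb : b.holds σ
  · obtain ⟨t, σ', h1, h2, h3⟩ := h hb
    exact ⟨_, _, .branch_true hb h1, Nat.add_le_add_left h2 _, h3⟩
  · obtain ⟨t, σ', h1, h2, h3⟩ := h' hb
    exact ⟨_, _, .branch_false hb h1, Nat.add_le_add_left h2 _, h3⟩

/-- Amortized analysis of a loop: `I a σ` says that the memory `σ` satisfies the invariant and has
potential `a`, and each round is paid for by a decrease of the potential. -/
theorem reaches_loop {I : ℕ → Memory → Prop}
    (step : ∀ a σ, I a σ → b.holds σ →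
      ∃ T a', p.Reaches σ T (I a') ∧ b.cost + 1 + T + a' ≤ a)
    {a : ℕ} (hI : I a σ) :
    (Program.loop b p).Reaches σ (a + b.cost + 1) (fun σ' => ¬ b.holds σ' ∧ ∃ a', I a' σ') := by
  induction a using Nat.strong_induction_on generalizing σ with
  | _ a ih =>
    by_cases hb : b.holds σ
    · obtain ⟨T, a', ⟨t, σ', h1, h2, h3⟩, h4⟩ := step a σ hI hb
      obtain ⟨t', σ'', h5, h6, h7⟩ := ih a' (by omega) h3
      exact ⟨_, _, .loop_step hb h1 h5, by omega, h7⟩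
    · exact ⟨_, _, Runs.loop_stop hb, by omega, hb, a, hI⟩

end Program

/-! ### The representation of the states -/

/-- The part of the memory that does not change. -/
structure Static (N : Network (Fin n) (Fin m)) (γ : Fin n → ℝ) (lo li : Fin n → List (Fin m))
    (σ : Memory) : Prop where
  n_eq : σ.natVar 0 = n
  m_eq : σ.natVar 1 = m
  internal : ∀ v : Fin n, σ.natArr 0 v = 0 ↔ N.Internal v
  source : ∀ v : Fin n, σ.natArr 0 v = 1 ↔ v ∈ N.S
  tail : ∀ e : Fin m, σ.natArr 1 e = N.tail e
  head : ∀ e : Fin m, σ.natArr 2 e = N.head e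
  -- Lists of a state are suffixes of the initial ones, so these fixed pointers serve all states.
  -- Entering lists are traversed from their end, hence by the `prev` pointers.
  next : ∀ v e t, e :: t <:+ lo v → σ.natArr 5 e = edgeRef t.head?
  prev : ∀ v e t, e :: t <:+ (li v).reverse → σ.natArr 10 e = edgeRef t.head?
  gamma : ∀ v : Fin n, N.Internal v → σ.realArr 1 v = γ v

/-- The memory `σ` represents the state `X`. -/
structure Rep (N : Network (Fin n) (Fin m)) (γ : Fin n → ℝ) (lo li : Fin n → List (Fin m))
    (σ : Memory) (X : State n m) : Prop where
  static : Static N γ lo li σ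
  f : ∀ e : Fin m, σ.realArr 2 e = X.f e
  r : ∀ e : Fin m, σ.realArr 0 e = X.r e
  s : ∀ v : Fin n, σ.realArr 3 v = X.s v
  out : ∀ v : Fin n, σ.natArr 3 v = edgeRef (X.out v).head?
  inn : ∀ v : Fin n, σ.natArr 8 v = edgeRef (X.inn v).head?

theorem edgeRef_head?_eq_iff {l : List (Fin m)} : edgeRef l.head? = m ↔ l = [] := by
  cases l with
  | nil => simp [edgeRef]
  | cons p t => simpa [edgeRef] using p.2.ne

namespace Static

variable {N : Network (Fin n) (Fin m)} {lo li : Fin n → List (Fin m)} {γ : Fin n → ℝ}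
  {σ τ : Memory} {X : State n m}

theorem congr (h : Static N γ lo li σ) (h0 : τ.natVar 0 = σ.natVar 0)
    (h1 : τ.natVar 1 = σ.natVar 1) (hn : ∀ a, a ≠ 3 → a ≠ 8 → τ.natArr a = σ.natArr a)
    (hr : τ.realArr 1 = σ.realArr 1) : Static N γ lo li τ := by
  obtain ⟨g0, g1, g2, g3, g4, g5, g6, g7, g8⟩ := h
  constructor
  · rwa [h0]
  · rwa [h1]
  · rwa [hn 0 (by simp) (by simp)]
  · rwa [hn 0 (by simp) (by simp)]
  · rwa [hn 1 (by simp) (by simp)]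
  · rwa [hn 2 (by simp) (by simp)]
  · rwa [hn 5 (by simp) (by simp)]
  · rwa [hn 10 (by simp) (by simp)]
  · rwa [hr]

end Static

theorem HoldsInput.static {N : Network (Fin n) (Fin m)} {γ : Fin n → ℝ} {σ : Memory}
    (h : HoldsInput N γ σ) : ∃ lo li, Lists N lo li ∧ Static N γ lo li σ ∧
      (∀ v : Fin n, σ.natArr 3 v = edgeRef (lo v).head?) ∧
      (∀ v : Fin n, σ.natArr 8 v = edgeRef (li v).reverse.head?) ∧
      (∀ e : Fin m, σ.realArr 0 e = N.c e) := by
  obtain ⟨h0, h1, h2, h3, ⟨lo, hlo, ho⟩, ⟨li, hli, hi⟩, hc, hγ⟩ := h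
  refine ⟨lo, li, ⟨hlo, hli⟩, ⟨h0, h1, fun v => ⟨fun h => ⟨fun hS => ?_, fun hT => ?_⟩, (h2 v).1⟩,
    fun v => ⟨fun h => ?_, (h2 v).2.1⟩, fun e => (h3 e).1, fun e => (h3 e).2, fun v e t ht => ?_,
    fun v e t ht => ?_, hγ⟩, fun v => (ho v).1, fun v => ?_, hc⟩
  · have := (h2 v).2.1 hS; omega
  · have := (h2 v).2.2 hT; omega
  · by_contra hS
    by_cases hT : v ∈ N.T
    · have := (h2 v).2.2 hT; omega
    · have := (h2 v).1 ⟨hS, hT⟩; omega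
  · obtain ⟨l, hl⟩ := ht
    have hlen : l.length < (lo v).length := by rw [← hl]; simp
    have hk := ((ho v).2.2 l.length hlen).1
    have e1 : (lo v)[l.length] = e := by simp [← hl]
    have e2 : (lo v)[l.length + 1]? = t.head? := by
      rw [← hl, List.getElem?_append_right (by omega)]
      simp [List.head?_eq_getElem?]
    rwa [e1, e2] at hk
  · obtain ⟨l, hl⟩ := ht
    have hl' : li v = t.reverse ++ e :: l.reverse := by
      rw [← List.reverse_reverse (li v), ← hl]; simp
    have hlen : t.length < (li v).length := by rw [hl']; simp
    have hk := ((hi v).2.2 t.length hlen).2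
    have e1 : (li v)[t.length] = e := by simp [hl']
    rw [e1] at hk
    rw [hk]
    rcases t with _ | ⟨a, t⟩
    · simp
    · congr 1
      simp [hl']
  · rw [(hi v).2.1, List.head?_reverse]

namespace Rep

variable {N : Network (Fin n) (Fin m)} {lo li : Fin n → List (Fin m)} {γ : Fin n → ℝ}
  {σ τ : Memory} {X : State n m}

theorem congr (h : Rep N γ lo li σ X) (h0 : τ.natVar 0 = σ.natVar 0)
    (h1 : τ.natVar 1 = σ.natVar 1) (hn : τ.natArr = σ.natArr) (hr : τ.realArr = σ.realArr) :
    Rep N γ lo li τ X := by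
  refine ⟨h.static.congr h0 h1 (fun a _ _ => by rw [hn]) (by rw [hr]), ?_, ?_, ?_, ?_, ?_⟩
  · rw [hr]; exact h.f
  · rw [hr]; exact h.r
  · rw [hr]; exact h.s
  · rw [hn]; exact h.out
  · rw [hn]; exact h.inn

theorem setNat (h : Rep N γ lo li σ X) {x : ℕ} (hx : 2 ≤ x) (k : ℕ) :
    Rep N γ lo li (σ.setNat x k) X :=
  h.congr (by simp [show 0 ≠ x by omega]) (by simp [show 1 ≠ x by omega]) rfl rfl

theorem setReal (h : Rep N γ lo li σ X) (x : ℕ) (c : ℝ) : Rep N γ lo li (σ.setReal x c) X :=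
  h.congr rfl rfl rfl rfl

theorem put_f (h : Rep N γ lo li σ X) (e : Fin m) (c : ℝ) :
    Rep N γ lo li (σ.putReal 2 e c) { X with f := update X.f e c } := by
  refine ⟨h.static.congr rfl rfl (fun a _ _ => rfl) (by simp), fun e' => ?_, ?_, ?_, h.out, h.inn⟩
  · by_cases he : e' = e
    · simp [he]
    · simp [he, Fin.val_ne_of_ne he, h.f]
  · simpa using h.r
  · simpa using h.s

theorem put_r (h : Rep N γ lo li σ X) (e : Fin m) (c : ℝ) :
    Rep N γ lo li (σ.putReal 0 e c) { X with r := update X.r e c } := by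
  refine ⟨h.static.congr rfl rfl (fun a _ _ => rfl) (by simp), ?_, fun e' => ?_, ?_, h.out, h.inn⟩
  · simpa using h.f
  · by_cases he : e' = e
    · simp [he]
    · simp [he, Fin.val_ne_of_ne he, h.r]
  · simpa using h.s

theorem put_s (h : Rep N γ lo li σ X) (v : Fin n) (c : ℝ) :
    Rep N γ lo li (σ.putReal 3 v c) { X with s := update X.s v c } := by
  refine ⟨h.static.congr rfl rfl (fun a _ _ => rfl) (by simp), ?_, ?_, fun e' => ?_, h.out, h.inn⟩
  · simpa using h.f
  · simpa using h.r
  · by_cases he : e' = v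
    · simp [he]
    · simp [he, Fin.val_ne_of_ne he, h.s]

theorem put_out (h : Rep N γ lo li σ X) (v : Fin n) (t : List (Fin m)) :
    Rep N γ lo li (σ.putNat 3 v (edgeRef t.head?)) { X with out := update X.out v t } := by
  refine ⟨h.static.congr rfl rfl (fun a h3 h8 => by simp [h3]) rfl, h.f, h.r, h.s,
    fun w => ?_, ?_⟩
  · by_cases he : w = v
    · simp [he]
    · simp [he, Fin.val_ne_of_ne he, h.out]
  · simpa using h.inn

theorem put_inn (h : Rep N γ lo li σ X) (v : Fin n) (t : List (Fin m)) :
    Rep N γ lo li (σ.putNat 8 v (edgeRef t.head?)) { X with inn := update X.inn v t } := by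
  refine ⟨h.static.congr rfl rfl (fun a h3 h8 => by simp [h8]) rfl, h.f, h.r, h.s,
    ?_, fun w => ?_⟩
  · simpa using h.out
  · by_cases he : w = v
    · simp [he]
    · simp [he, Fin.val_ne_of_ne he, h.inn]

end Rep

/-! ### The program -/

open NatExpr RealExpr Test Program

/-- Is the vertex in variable `2` active? -/
def activeTest : Test := both (natEq (.get 0 (.var 2)) (.const 0)) (realLt .zero (.get 3 (.var 2)))

/-- Is the list of edges leaving the vertex in variable `2` exhausted? -/
def exhaustedTest : Test := natEq (.get 3 (.var 2)) (.var 1)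

/-- Find the current edge (variable `5`) of the vertex in variable `2`, the amount that can be pushed
along it (real variable `0`), and its other end (variable `6`). -/
def look : Program :=
  .branch exhaustedTest
    (.seq (.setNat 5 (.get 8 (.var 2)))
      (.seq (.setReal 0 (.get 2 (.var 5))) (.setNat 6 (.get 1 (.var 5)))))
    (.seq (.setNat 5 (.get 3 (.var 2)))
      (.seq (.setReal 0 (.get 0 (.var 5))) (.setNat 6 (.get 2 (.var 5)))))

/-- Push the amount in real variable `1` along the current edge. -/
def pushProgram : Program :=
  .branch exhaustedTest
    (.putReal 2 (.var 5) (.sub (.get 2 (.var 5)) (.var 1)))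
    (.seq (.putReal 2 (.var 5) (.add (.get 2 (.var 5)) (.var 1)))
      (.putReal 0 (.var 5) (.sub (.get 0 (.var 5)) (.var 1))))

/-- Push the amount in real variable `1` of the surplus along the current edge. -/
def sendProgram : Program :=
  .seq pushProgram (.seq (.putReal 3 (.var 2) (.sub (.get 3 (.var 2)) (.var 1)))
    (.putReal 3 (.var 6) (.add (.get 3 (.var 6)) (.var 1))))

/-- Is the current edge ready for a push? -/
def readyTest : Test :=
  both (neg (realEq (.var 0) .zero))
    (neg (both exhaustedTest (neg (realEq (.get 0 (.var 5)) .zero))))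

/-- Close the current edge, or pass to the next edge of a list. -/
def advanceProgram : Program :=
  .branch exhaustedTest
    (.branch (realEq (.get 0 (.var 5)) .zero)
      (.putNat 8 (.var 2) (.get 10 (.var 5)))
      (.putReal 0 (.var 5) .zero))
    (.seq (.putNat 3 (.var 2) (.get 5 (.var 5)))
      (.branch exhaustedTest
        (.putReal 3 (.var 2) (.sub (.get 3 (.var 2)) (.get 1 (.var 2)))) .skip))

/-- Start again with looking for an active vertex. -/
def restart : Program := .seq (.setNat 2 (.const 0)) (.setNat 3 (.const 0))

def awayTest : Test := neg (natEq (.var 2) (.var 4))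

/-- Replace the amount in real variable `1` by what can be pushed from here, if this is smaller. -/
def measureStep : Program :=
  .seq look (.seq (.branch (realLt (.var 0) (.var 1)) (.setReal 1 (.var 0)) .skip)
    (.setNat 2 (.var 6)))

def pushStep : Program := .seq look (.seq pushProgram (.setNat 2 (.var 6)))

/-- Push as much as possible round the cycle through the vertex in variable `2`. -/
def cycleProgram : Program :=
  .seq (.seq (.setNat 4 (.var 2)) (.seq look (.seq (.setReal 1 (.var 0)) (.setNat 2 (.var 6)))))
    (.seq (.loop awayTest measureStep) (.seq pushStep (.loop awayTest pushStep)))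

def walkStep : Program :=
  .seq look (.branch readyTest
    (.branch (realLt (.get 3 (.var 2)) (.var 0))
      (.seq (.setReal 1 (.get 3 (.var 2))) (.seq sendProgram
        (.seq (.setNat 2 (.var 6)) (.branch activeTest (.setNat 3 (.succ (.var 3))) restart))))
      (.seq (.setReal 1 (.var 0)) (.seq sendProgram restart)))
    (.seq advanceProgram restart))

/-- The round of the main loop. -/
def mainStep : Program :=
  .branch activeTest
    (.branch (natEq (.var 3) (.var 0)) (.seq cycleProgram restart) walkStep)
    (.setNat 2 (.succ (.var 2)))

def vertexTest : Test := natLt (.var 2) (.var 0)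

def edgeTest : Test := natLt (.var 2) (.var 1)

def initVertex : Program :=
  .seq (.branch exhaustedTest (.putReal 3 (.var 2) (.sub .zero (.get 1 (.var 2))))
    (.putReal 3 (.var 2) .zero)) (.setNat 2 (.succ (.var 2)))

def initEdge : Program :=
  .seq (.branch (natEq (.get 0 (.get 1 (.var 2))) (.const 1))
    (.seq (.putReal 2 (.var 2) (.get 0 (.var 2)))
      (.seq (.putReal 0 (.var 2) .zero)
        (.putReal 3 (.get 2 (.var 2)) (.add (.get 3 (.get 2 (.var 2))) (.get 2 (.var 2))))))
    (.putReal 2 (.var 2) .zero)) (.setNat 2 (.succ (.var 2)))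

def initProgram : Program :=
  .seq (.seq (.setNat 2 (.const 0)) (.loop vertexTest initVertex))
    (.seq (.setNat 2 (.const 0)) (.loop edgeTest initEdge))

def stableFlowProgram : Program :=
  .branch (natEq (.var 1) (.const 0)) .skip
    (.seq initProgram (.seq restart (.loop vertexTest mainStep)))

/-! ### Correctness of the loop-free pieces -/

variable {N : Network (Fin n) (Fin m)} {lo li : Fin n → List (Fin m)} {γ : Fin n → ℝ}
  {σ τ : Memory} {X : State n m} {u w v : Fin n} {e : Fin m} {d : ℝ}

/-- `e` is the current edge of `u`. -/
def State.IsCurrent (X : State n m) (u : Fin n) (e : Fin m) : Prop :=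
  (∃ t, X.out u = e :: t) ∨ (X.out u = [] ∧ ∃ t, X.inn u = e :: t)

theorem State.Ready.exists_current (h : X.Ready N u) : ∃ e, X.IsCurrent u e := by
  obtain ⟨-, ⟨p, t, h, -⟩ | ⟨q, t, h, h', -⟩⟩ := h
  exacts [⟨p, .inl ⟨t, h⟩⟩, ⟨q, .inr ⟨h, t, h'⟩⟩]

theorem State.Valid.exists_current (hX : X.Valid N γ lo li)
    (hγ : ∀ v, N.Internal v → 0 ≤ γ v) (hu : X.Active N u) : ∃ e, X.IsCurrent u e := by
  rcases h : X.out u with _ | ⟨p, t⟩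
  · obtain ⟨q, t, h'⟩ := hX.exists_inn hγ hu h
    exact ⟨q, .inr ⟨h, t, h'⟩⟩
  · exact ⟨p, .inl ⟨t, h⟩⟩

theorem Rep.exhaustedTest_iff (hR : Rep N γ lo li σ X) (hu : σ.natVar 2 = u) :
    exhaustedTest.holds σ ↔ X.out u = [] := by
  simp only [exhaustedTest, Test.holds, NatExpr.eval, hu, hR.out, hR.static.m_eq,
    edgeRef_head?_eq_iff]

theorem Rep.activeTest_iff (hR : Rep N γ lo li σ X) (hu : σ.natVar 2 = u) :
    activeTest.holds σ ↔ X.Active N u := by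
  simp only [activeTest, Test.holds, NatExpr.eval, RealExpr.eval, hu, hR.static.internal, hR.s,
    State.Active]

theorem Rep.look_post (hR : Rep N γ lo li σ X) (hu : σ.natVar 2 = u) (he : X.IsCurrent u e) :
    look.post σ = ((σ.setNat 5 e).setReal 0 (X.res u)).setNat 6 (X.nxt N u) := by
  have h1 := hR.exhaustedTest_iff hu
  obtain ⟨t, h⟩ | ⟨h, t, h'⟩ := he
  · rw [look, post, if_neg (by rw [h1, h]; simp), State.res_of_out h, State.nxt_of_out h]
    simp [post, NatExpr.eval, RealExpr.eval, hu, hR.out, h, edgeRef, hR.r, hR.static.head]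
  · rw [look, post, if_pos (by rw [h1, h]), State.res_of_inn h h', State.nxt_of_inn h h']
    simp [post, NatExpr.eval, RealExpr.eval, hu, hR.inn, h', edgeRef, hR.f, hR.static.tail]

theorem Rep.push_post (hR : Rep N γ lo li σ X) (hu : σ.natVar 2 = u) (he : X.IsCurrent u e)
    (he' : σ.natVar 5 = e) (hd : σ.realVar 1 = d) :
    Rep N γ lo li (pushProgram.post σ) (X.push u d) ∧
      (pushProgram.post σ).natVar = σ.natVar ∧ (pushProgram.post σ).realVar = σ.realVar := by
  have h1 := hR.exhaustedTest_iff hu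
  obtain ⟨t, h⟩ | ⟨h, t, h'⟩ := he
  · rw [pushProgram, Program.post, if_neg (by rw [h1, h]; simp), State.push_of_out h]
    have h2 := (hR.put_f e (X.f e + d)).put_r e (X.r e - d)
    simpa [Program.post, NatExpr.eval, RealExpr.eval, he', hR.f, hR.r, hd] using h2
  · rw [pushProgram, Program.post, if_pos (by rw [h1, h]), State.push_of_inn h h']
    have h2 := hR.put_f e (X.f e - d)
    simpa [Program.post, NatExpr.eval, RealExpr.eval, he', hR.f, hR.r, hd] using h2

/-- The second surplus is read after the first has been written, which is harmless because `nxt`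
differs from `u`. -/
theorem Rep.send_post (hR : Rep N γ lo li σ X) (hu : σ.natVar 2 = u) (he : X.IsCurrent u e)
    (he' : σ.natVar 5 = e) (hd : σ.realVar 1 = d) (hw : σ.natVar 6 = X.nxt N u)
    (hne : X.nxt N u ≠ u) :
    Rep N γ lo li (sendProgram.post σ) (X.send N u d) ∧
      (sendProgram.post σ).natVar = σ.natVar := by
  obtain ⟨h1, h2, h3⟩ := hR.push_post hu he he' hd
  have h4 := (h1.put_s u (X.s u - d)).put_s (X.nxt N u) (X.s (X.nxt N u) + d)
  simp only [sendProgram, Program.post, NatExpr.eval, RealExpr.eval, h2, h3, hu, hd, hw, h1.s,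
    Memory.putReal_natVar, Memory.putReal_realVar, Memory.putReal_realArr, update_self,
    update_of_ne (Fin.val_ne_of_ne hne), State.push_s, and_true]
  simpa [State.send] using h4

theorem Rep.readyTest_iff (hR : Rep N γ lo li σ X) (hX : X.Core N lo li) (hu : σ.natVar 2 = u)
    (hi : N.Internal u) (he : X.IsCurrent u e) (he' : σ.natVar 5 = e)
    (hr : σ.realVar 0 = X.res u) : readyTest.holds σ ↔ X.Ready N u := by
  have h1 := hR.exhaustedTest_iff hu
  simp only [readyTest, Test.holds, RealExpr.eval, NatExpr.eval, hr, he', hR.r, h1]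
  obtain ⟨t, h⟩ | ⟨h, t, h'⟩ := he
  · rw [State.res_of_out h]
    constructor
    · rintro ⟨h2, -⟩
      exact ⟨hi, .inl ⟨e, t, h, lt_of_le_of_ne (hX.r_nonneg e) (Ne.symm h2)⟩⟩
    · intro h2
      have := h2.res_pos
      rw [State.res_of_out h] at this
      exact ⟨this.ne', by simp [h]⟩
  · rw [State.res_of_inn h h']
    constructor
    · rintro ⟨h2, h3⟩
      refine ⟨hi, .inr ⟨e, t, h, h', ?_, lt_of_le_of_ne (hX.f_nonneg e) (Ne.symm h2)⟩⟩
      by_contra h4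
      exact h3 ⟨h, h4⟩
    · rintro ⟨-, ⟨p, t', k, -⟩ | ⟨q, t', -, k', h5, h6⟩⟩
      · simp [h] at k
      · rw [h'] at k'
        obtain ⟨rfl, -⟩ := List.cons.inj k'
        exact ⟨h6.ne', fun h7 => h7.2 h5⟩

/-- A current edge that is not ready is a leaving edge with `r = 0`, an entering edge still to be
closed, or an entering edge with `f = r = 0`. Each case is an event. -/
theorem Rep.advance_post (hL : Lists N lo li) (hγ : ∀ v, N.Internal v → 0 ≤ γ v)
    (hR : Rep N γ lo li σ X) (hX : X.Valid N γ lo li) (hu : σ.natVar 2 = u)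
    (hi : N.Internal u) (he : X.IsCurrent u e) (he' : σ.natVar 5 = e) (hn : ¬ X.Ready N u) :
    ∃ Y : State n m, Y.Valid N γ lo li ∧ Y.potential N < X.potential N ∧
      Rep N γ lo li (advanceProgram.post σ) Y := by
  have h1 := hR.exhaustedTest_iff hu
  have hc := hX.core
  obtain ⟨t, h⟩ | ⟨h, t, h'⟩ := he
  · have hr : X.r e = 0 := by
      by_contra h2
      exact hn ⟨hi, .inl ⟨e, t, h, lt_of_le_of_ne (hc.r_nonneg e) (Ne.symm h2)⟩⟩
    obtain ⟨k1, k2⟩ := hX.advanceOut hγ hi h hr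
    refine ⟨_, k1, k2, ?_⟩
    have h2 := hR.put_out u t
    have h3 := h2.exhaustedTest_iff (u := u) (by simpa using hu)
    have hnext := hR.static.next u e t (h ▸ hc.out_suffix u)
    rw [advanceProgram, Program.post, if_neg (by rw [h1, h]; simp)]
    simp only [Program.post, NatExpr.eval, RealExpr.eval, hu, he', hnext, h3, update_self,
      h2.s, h2.static.gamma u hi, Memory.putNat_natVar]
    by_cases ht : t = []
    · have h4 := h2.put_s u (X.s u - γ u)
      rw [if_pos ht]
      simpa [State.advanceOut, ht] using h4
    · rw [if_neg ht]
      simpa [State.advanceOut, ht] using h2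
  · rw [advanceProgram, Program.post, if_pos (by rw [h1, h])]
    simp only [Program.post, NatExpr.eval, RealExpr.eval, hu, he', Test.holds, hR.r]
    by_cases hr : X.r e = 0
    · have hf : X.f e = 0 := by
        by_contra h2
        exact hn ⟨hi, .inr ⟨e, t, h, h', hr, lt_of_le_of_ne (hc.f_nonneg e) (Ne.symm h2)⟩⟩
      obtain ⟨k1, k2⟩ := hX.advanceInn h' hr hf
      refine ⟨_, k1, k2, ?_⟩
      rw [if_pos hr, hR.static.prev u e t (h' ▸ hc.inn_suffix u)]
      exact hR.put_inn u t
    · obtain ⟨k1, k2⟩ := hX.close hL hi h h' hr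
      refine ⟨_, k1, k2, ?_⟩
      rw [if_neg hr]
      exact hR.put_r e 0

theorem Rep.restart (hR : Rep N γ lo li σ X) : Rep N γ lo li (restart.post σ) X ∧
    (restart.post σ).natVar 2 = 0 ∧ (restart.post σ).natVar 3 = 0 := by
  refine ⟨?_, ?_, ?_⟩
  · exact (hR.setNat (by norm_num) _).setNat (by norm_num) _
  · simp [StableFlow.restart, Program.post, NatExpr.eval]
  · simp [StableFlow.restart, Program.post, NatExpr.eval]

/-- What a step of a walk achieves: an event, or the transfer of the surplus to the next vertex. -/
def WalkGoal (N : Network (Fin n) (Fin m)) (X Y : State n m) (u : Fin n) (k : ℕ) (τ : Memory) :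
    Prop :=
  (Y.potential N < X.potential N ∧ τ.natVar 2 = 0 ∧ τ.natVar 3 = 0) ∨
  (Y.potential N ≤ X.potential N ∧ X.Ready N u ∧ Y.nxt N = X.nxt N ∧
    (∀ w, X.Ready N w → Y.Ready N w) ∧ τ.natVar 2 = X.nxt N u ∧ τ.natVar 3 = k + 1 ∧
    Y.Active N (X.nxt N u))

theorem State.Ready.send (hL : Lists N lo li) (hX : X.Core N lo li) (hu : X.Ready N u)
    (hd : d < X.res u) (hw : X.Ready N w) : (X.send N u d).Ready N w := by
  by_cases h : w = u
  · subst h; exact hu.push_self hd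
  · exact (hX.push_other hL hu hw h).1

theorem Rep.walkStep_post (hL : Lists N lo li) (hγ : ∀ v, N.Internal v → 0 ≤ γ v)
    (hR : Rep N γ lo li σ X) (hX : X.Valid N γ lo li) (hu : σ.natVar 2 = u)
    (ha : X.Active N u) :
    ∃ Y : State n m, Y.Valid N γ lo li ∧ Rep N γ lo li (walkStep.post σ) Y ∧
      WalkGoal N X Y u (σ.natVar 3) (walkStep.post σ) := by
  obtain ⟨e, he⟩ := hX.exists_current hγ ha
  have hlook := hR.look_post hu he
  set σ1 := look.post σ with hσ1
  have hR1 : Rep N γ lo li σ1 X := by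
    rw [hlook]
    exact ((hR.setNat (by norm_num) _).setReal _ _).setNat (by norm_num) _
  have hu1 : σ1.natVar 2 = u := by rw [hlook]; simpa using hu
  have hk1 : σ1.natVar 3 = σ.natVar 3 := by rw [hlook]; simp
  have he1 : σ1.natVar 5 = e := by rw [hlook]; simp
  have hr1 : σ1.realVar 0 = X.res u := by rw [hlook]; simp
  have hw1 : σ1.natVar 6 = X.nxt N u := by rw [hlook]; simp
  have hready := hR1.readyTest_iff hX.core hu1 ha.1 he he1 hr1
  have hlt_iff : (realLt (.get 3 (.var 2)) (.var 0)).holds σ1 ↔ X.s u < X.res u := by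
    simp only [Test.holds, RealExpr.eval, NatExpr.eval, hu1, hR1.s, hr1]
  rw [walkStep, Program.post, ← hσ1]
  by_cases hre : X.Ready N u
  · have hne := hX.core.nxt_ne hL hre
    rw [post_branch_pos (hready.2 hre)]
    -- The inequality is strict so that `u` remains ready after the transfer; in case of equality
    -- the push exhausts the edge and counts as an event.
    by_cases hlt : X.s u < X.res u
    · have hset : (Program.setReal 1 (.get 3 (.var 2))).post σ1 = σ1.setReal 1 (X.s u) := by
        simp only [Program.post, RealExpr.eval, NatExpr.eval, hu1, hR1.s]
      rw [post_branch_pos (hlt_iff.2 hlt), Program.post, hset, Program.post, Program.post]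
      obtain ⟨h2, h3⟩ := (hR1.setReal 1 (X.s u)).send_post (d := X.s u) (by simpa using hu1) he
        (by simpa using he1) (by simp) (by simpa using hw1) hne
      set σ2 := sendProgram.post (σ1.setReal 1 (X.s u)) with hσ2
      have hV := hX.send hL hγ hre ha.2.le hlt.le le_rfl
      obtain ⟨p1, p2⟩ := State.potential_send_full hre ha hne hlt.le
      have hR3 : Rep N γ lo li ((Program.setNat 2 (.var 6)).post σ2) (X.send N u (X.s u)) :=
        h2.setNat (x := 2) (by norm_num) (σ2.natVar 6)
      have hu3 : ((Program.setNat 2 (.var 6)).post σ2).natVar 2 = X.nxt N u := by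
        simp [Program.post, NatExpr.eval, h3, hw1]
      have hk3 : ((Program.setNat 2 (.var 6)).post σ2).natVar 3 = σ.natVar 3 := by
        simp [Program.post, NatExpr.eval, h3, hk1]
      set σ3 := (Program.setNat 2 (.var 6)).post σ2
      have hact := hR3.activeTest_iff hu3
      by_cases hA : (X.send N u (X.s u)).Active N (X.nxt N u)
      · rw [post_branch_pos (hact.2 hA)]
        refine ⟨_, hV, hR3.setNat (by norm_num) _, .inr ⟨p1, hre, State.send_nxt,
          fun w hw => hre.send hL hX.core hlt hw, ?_, ?_, hA⟩⟩
        · simpa [Program.post] using hu3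
        · simp [Program.post, NatExpr.eval, hk3]
      · rw [post_branch_neg (fun h => hA (hact.1 h))]
        obtain ⟨r1, r2, r3⟩ := hR3.restart
        exact ⟨_, hV, r1, .inl ⟨p2 hA, r2, r3⟩⟩
    · have hset : (Program.setReal 1 (.var 0)).post σ1 = σ1.setReal 1 (X.res u) := by
        simp only [Program.post, RealExpr.eval, hr1]
      rw [post_branch_neg (fun h => hlt (hlt_iff.1 h)), Program.post, hset, Program.post]
      obtain ⟨h2, h3⟩ := (hR1.setReal 1 (X.res u)).send_post (d := X.res u) (by simpa using hu1) he
        (by simpa using he1) (by simp) (by simpa using hw1) hne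
      obtain ⟨r1, r2, r3⟩ := h2.restart
      exact ⟨_, hX.send hL hγ hre hre.res_pos.le le_rfl (not_lt.1 hlt), r1,
        .inl ⟨State.potential_send_saturating hre, r2, r3⟩⟩
  · rw [post_branch_neg (fun h => hre (hready.1 h)), Program.post]
    obtain ⟨Y, h1, h2, h3⟩ := hR1.advance_post hL hγ hX hu1 ha.1 he he1 hre
    obtain ⟨r1, r2, r3⟩ := h3.restart
    exact ⟨Y, h1, r1, .inl ⟨h2, r2, r3⟩⟩

theorem Rep.measureStep_post (hR : Rep N γ lo li σ X) (hu : σ.natVar 2 = u) (hr : X.Ready N u) :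
    Rep N γ lo li (measureStep.post σ) X ∧ (measureStep.post σ).natVar 2 = X.nxt N u ∧
      (measureStep.post σ).natVar 4 = σ.natVar 4 ∧
      (measureStep.post σ).realVar 1 = min (σ.realVar 1) (X.res u) := by
  obtain ⟨e, he⟩ := hr.exists_current
  rw [measureStep, Program.post, hR.look_post hu he]
  have hR1 := ((hR.setNat (x := 5) (by norm_num) e).setReal 0 (X.res u)).setNat (x := 6)
    (by norm_num) (X.nxt N u)
  by_cases hlt : X.res u < σ.realVar 1
  · rw [Program.post, post_branch_pos (by simpa [Test.holds, RealExpr.eval] using hlt)]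
    refine ⟨(hR1.setReal 1 _).setNat (by norm_num) _, ?_, ?_, ?_⟩ <;>
      simp [Program.post, NatExpr.eval, RealExpr.eval, hlt.le]
  · rw [Program.post, post_branch_neg (by simpa [Test.holds, RealExpr.eval] using hlt)]
    refine ⟨hR1.setNat (by norm_num) _, ?_, ?_, ?_⟩ <;>
      simp [Program.post, NatExpr.eval, not_lt.1 hlt]

theorem Rep.pushStep_post (hR : Rep N γ lo li σ X) (hu : σ.natVar 2 = u) (hr : X.Ready N u) :
    Rep N γ lo li (pushStep.post σ) (X.push u (σ.realVar 1)) ∧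
      (pushStep.post σ).natVar 2 = X.nxt N u ∧
      (pushStep.post σ).natVar 4 = σ.natVar 4 ∧
      (pushStep.post σ).realVar 1 = σ.realVar 1 := by
  obtain ⟨e, he⟩ := hr.exists_current
  rw [pushStep, Program.post, hR.look_post hu he, Program.post]
  have hR1 := ((hR.setNat (x := 5) (by norm_num) e).setReal 0 (X.res u)).setNat (x := 6)
    (by norm_num) (X.nxt N u)
  obtain ⟨h1, h2, h3⟩ := hR1.push_post (d := σ.realVar 1) (by simpa using hu) he
    (by simp) (by simp)
  refine ⟨h1.setNat (by norm_num) _, ?_, ?_, ?_⟩ <;>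
    simp [Program.post, NatExpr.eval, h2, h3]

/-! ### The push round a cycle -/

theorem iterate_ne_iff {g : Fin n → Fin n} {j : ℕ} (h1 : 1 ≤ j)
    (h2 : j ≤ minimalPeriod g u) : g^[j] u ≠ u ↔ j < minimalPeriod g u := by
  constructor
  · intro h
    refine lt_of_le_of_ne h2 ?_
    rintro rfl
    exact h iterate_minimalPeriod
  · intro h h3
    exact not_isPeriodicPt_of_pos_of_lt_minimalPeriod (by omega) h h3

theorem measureStep_reaches : measureStep.Reaches σ 50 (fun τ => τ = measureStep.post σ) :=
  (Straight.reaches (by simp [Straight, measureStep, look]) rfl).mono (by decide)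
    fun _ h => h.symm

theorem pushStep_reaches : pushStep.Reaches σ 50 (fun τ => τ = pushStep.post σ) :=
  (Straight.reaches (by simp [Straight, pushStep, look, pushProgram]) rfl).mono (by decide)
    fun _ h => h.symm

theorem Rep.cycleProgram_reaches (hL : Lists N lo li)
    (hR : Rep N γ lo li σ X) (hX : X.Valid N γ lo li) (hu : σ.natVar 2 = u)
    (hper : u ∈ periodicPts (X.nxt N)) (hready : ∀ i, X.Ready N ((X.nxt N)^[i] u)) :
    cycleProgram.Reaches σ (200 * (n + 1)) (fun τ => ∃ Y : State n m, Y.Valid N γ lo li ∧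
      Y.potential N < X.potential N ∧ Rep N γ lo li τ Y) := by
  set g := X.nxt N with hg
  set L := minimalPeriod g u with hLdef
  have hLpos : 0 < L := minimalPeriod_pos_of_mem_periodicPts hper
  have hLn : L ≤ n := minimalPeriod_le g u
  have haway : ∀ (τ : Memory) (j : ℕ), 1 ≤ j → j ≤ L → τ.natVar 4 = u → τ.natVar 2 = g^[j] u →
      (awayTest.holds τ ↔ j < L) := by
    intro τ j h1 h2 h3 h4
    rw [← iterate_ne_iff h1 h2]
    simp only [awayTest, Test.holds, NatExpr.eval, h3, h4, Fin.val_inj, ne_eq]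
  -- measuring
  let I (a : ℕ) (τ : Memory) : Prop := ∃ j, 1 ≤ j ∧ j ≤ L ∧ τ.natVar 4 = u ∧
    τ.natVar 2 = g^[j] u ∧ Rep N γ lo li τ X ∧ (∀ i < j, τ.realVar 1 ≤ X.res (g^[i] u)) ∧
    (∃ i < j, τ.realVar 1 = X.res (g^[i] u)) ∧ a = 60 * (L - j)
  have hstep1 : ∀ a τ, I a τ → awayTest.holds τ →
      ∃ T a', measureStep.Reaches τ T (I a') ∧ awayTest.cost + 1 + T + a' ≤ a := by
    rintro a τ ⟨j, h1, h2, h3, h4, h5, h6, ⟨i, hi, hi'⟩, rfl⟩ hb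
    have hj := (haway τ j h1 h2 h3 h4).1 hb
    -- A round takes at most `4 + 1 + 50` steps, covered by the `60` units set aside per vertex of
    -- the cycle.
    refine ⟨50, 60 * (L - (j + 1)), measureStep_reaches.mono le_rfl ?_, ?_⟩
    · rintro _ rfl
      obtain ⟨k1, k2, k3, k4⟩ := h5.measureStep_post h4 (hready j)
      refine ⟨j + 1, by omega, hj, k3.trans h3, by rw [k2, iterate_succ_apply'], k1,
        fun l hl => ?_, ?_, rfl⟩
      · rw [k4]
        rcases Nat.lt_succ_iff_lt_or_eq.1 hl with hl | rfl
        · exact (min_le_left _ _).trans (h6 l hl)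
        · exact min_le_right _ _
      · rw [k4]
        rcases min_choice (τ.realVar 1) (X.res (g^[j] u)) with h | h
        · exact ⟨i, by omega, h.trans hi'⟩
        · exact ⟨j, by omega, h⟩
    · have : awayTest.cost = 4 := rfl
      omega
  -- On the way round, the memory represents a partial push, in which excesses and surpluses need
  -- not match; only `Core` is available until the cycle closes.
  let J (d : ℝ) (a : ℕ) (τ : Memory) : Prop := ∃ j, 1 ≤ j ∧ j ≤ L ∧ τ.natVar 4 = u ∧
    τ.natVar 2 = g^[j] u ∧ Rep N γ lo li τ (X.pushWalk N u d j) ∧ τ.realVar 1 = d ∧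
    a = 60 * (L - j)
  have hcost : awayTest.cost = 4 := rfl
  have hpush : ∀ (d : ℝ), 0 ≤ d → (∀ i, d ≤ X.res (g^[i] u)) → ∀ (j : ℕ) (τ : Memory), j < L →
      τ.natVar 4 = u → τ.natVar 2 = g^[j] u → Rep N γ lo li τ (X.pushWalk N u d j) →
      τ.realVar 1 = d → J d (60 * (L - (j + 1))) (pushStep.post τ) := by
    intro d hd hres j τ hj h3 h4 h5 h6
    obtain ⟨-, g2, -⟩ := State.pushWalk_spec hL hX.core hready hd hres j hj.le
    obtain ⟨k1, k2, k3, k4⟩ := h5.pushStep_post h4 (g2 j le_rfl hj).1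
    rw [h6] at k1 k4
    refine ⟨j + 1, by omega, hj, k3.trans h3, ?_, k1, k4, rfl⟩
    rw [k2, iterate_succ_apply', State.pushWalk_nxt]
  have hstep2 : ∀ (d : ℝ), 0 ≤ d → (∀ i, d ≤ X.res (g^[i] u)) → ∀ a τ, J d a τ →
      awayTest.holds τ →
      ∃ T a', pushStep.Reaches τ T (J d a') ∧ awayTest.cost + 1 + T + a' ≤ a := by
    rintro d hd hres a τ ⟨j, h1, h2, h3, h4, h5, h6, rfl⟩ hb
    have hj := (haway τ j h1 h2 h3 h4).1 hb
    refine ⟨50, 60 * (L - (j + 1)), pushStep_reaches.mono le_rfl ?_, by omega⟩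
    rintro _ rfl
    exact hpush d hd hres j τ hj h3 h4 h5 h6
  have hinit : (Program.seq (.setNat 4 (.var 2))
      (.seq look (.seq (.setReal 1 (.var 0)) (.setNat 2 (.var 6))))).Reaches σ 50
      (I (60 * (L - 1))) := by
    refine (Straight.reaches (Q := I (60 * (L - 1))) (by simp [Straight, look]) ?_).mono (by decide)
      fun _ h => h
    obtain ⟨e, he⟩ := (hready 0).exists_current
    have hR0 := hR.setNat (x := 4) (by norm_num) (σ.natVar 2)
    have hlook := hR0.look_post (u := u) (by simpa using hu) he
    rw [Program.post, Program.post, Program.post, NatExpr.eval, hlook, Program.post]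
    have hR1 := ((hR0.setNat (x := 5) (by norm_num) e).setReal 0 (X.res u)).setNat (x := 6)
      (by norm_num) (X.nxt N u)
    refine ⟨1, le_rfl, hLpos, ?_, ?_, (hR1.setReal 1 _).setNat (by norm_num) _, ?_, ⟨0, by simp, ?_⟩,
      rfl⟩
    · simp [Program.post, hu]
    · simp [Program.post, NatExpr.eval, hg]
    · intro i hi
      obtain rfl : i = 0 := by omega
      simp [Program.post, RealExpr.eval]
    · simp [Program.post, RealExpr.eval]
  refine (hinit.seq (fun τ hτ => (reaches_loop hstep1 hτ).seq (T' := 50 + (60 * (L - 1) + 4 + 1))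
    (R := fun τ => ∃ Y : State n m, Y.Valid N γ lo li ∧
      Y.potential N < X.potential N ∧ Rep N γ lo li τ Y) ?_)).mono ?_ fun _ h => h
  · rintro τ ⟨hb, a, j, h1, h2, h3, h4, h5, h6, ⟨i, hi, hi'⟩, -⟩
    have hjL : j = L := by
      have := (haway τ j h1 h2 h3 h4).not.1 hb
      omega
    subst hjL
    have hd : 0 ≤ τ.realVar 1 := hi' ▸ (hready i).res_pos.le
    -- The minimum was taken over one period, hence over the whole orbit.
    have hres : ∀ i, τ.realVar 1 ≤ X.res (g^[i] u) := by
      intro i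
      rw [← iterate_mod_minimalPeriod_eq]
      exact h6 _ (Nat.mod_lt _ hLpos)
    have hfirst : pushStep.Reaches τ 50 (J (τ.realVar 1) (60 * (L - 1))) := by
      refine pushStep_reaches.mono le_rfl ?_
      rintro _ rfl
      -- The measuring round has returned to `u`, the vertex with index `0` of the pushing round.
      -- Its first push precedes the loop, whose test would fail at once.
      exact hpush _ hd hres 0 τ hLpos h3 (by rw [h4, hLdef, iterate_minimalPeriod]; rfl) h5 rfl
    refine hfirst.seq fun ρ hρ => (reaches_loop (hstep2 _ hd hres) hρ).mono le_rfl ?_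
    rintro ρ' ⟨hb', a', j', g1, g2, g3, g4, g5, -, -⟩
    have hjL : j' = L := by
      have := (haway ρ' j' g1 g2 g3 g4).not.1 hb'
      omega
    subst hjL
    obtain ⟨p1, p2⟩ := hX.pushCycle hL hready hd hres ⟨i, hi, hi'⟩
    exact ⟨_, p1, p2, g5⟩
  · omega

/-! ### Amortized analysis of the main loop -/

theorem walkStep_reaches : walkStep.Reaches σ 200 (fun τ => τ = walkStep.post σ) :=
  (Straight.reaches (by simp [Straight, walkStep, look, sendProgram, pushProgram, restart,
    advanceProgram]) rfl).mono (by decide) fun _ h => h.symm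

/-- The invariant of the main loop. -/
def MainInvariant (N : Network (Fin n) (Fin m)) (γ : Fin n → ℝ) (lo li : Fin n → List (Fin m))
    (a : ℕ) (σ : Memory) : Prop :=
  ∃ (X : State n m) (b : ℕ), X.Valid N γ lo li ∧ Rep N γ lo li σ X ∧
    -- The time credit: each future event is worth `3 * n + 3` rounds, and `b` bounds the rounds
    -- before the next event. While scanning, `b` leaves room for the rest of the scan and a whole
    -- walk; on a walk of length `k` it is `n - k`.
    a = 300 * (X.potential N * (3 * n + 3) + b) ∧
    ((σ.natVar 3 = 0 ∧ σ.natVar 2 ≤ n ∧ (∀ v : Fin n, v < σ.natVar 2 → ¬ X.Active N v) ∧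
      b = 2 * n - σ.natVar 2) ∨
    (0 < σ.natVar 3 ∧ σ.natVar 3 ≤ n ∧ b = n - σ.natVar 3 ∧ ∃ v u : Fin n, σ.natVar 2 = u ∧
      X.Active N u ∧ (X.nxt N)^[σ.natVar 3] v = u ∧
      ∀ j < σ.natVar 3, X.Ready N ((X.nxt N)^[j] v)))

theorem MainInvariant.restart {Y : State n m} (hY : Y.Valid N γ lo li) (hR : Rep N γ lo li σ Y)
    (h2 : σ.natVar 2 = 0) (h3 : σ.natVar 3 = 0) :
    MainInvariant N γ lo li (300 * (Y.potential N * (3 * n + 3) + 2 * n)) σ :=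
  ⟨Y, 2 * n, hY, hR, rfl, .inl ⟨h3, by omega, fun v hv => by omega, by omega⟩⟩

/-- Of the `3 * n + 3` units that an event releases, `2 * n` renew the credit for scanning and
walking, and `n + 1` pay for the round itself, which may go round a cycle. -/
theorem potential_step {a b c : ℕ} (h : a < b) :
    300 * (a * (3 * n + 3) + 2 * n) + 300 * (n + 1) ≤ 300 * (b * (3 * n + 3) + c) := by
  have : (a + 1) * (3 * n + 3) ≤ b * (3 * n + 3) := Nat.mul_le_mul_right _ h
  rw [Nat.succ_mul] at this
  omega

theorem mainStep_reaches (hL : Lists N lo li) (hγ : ∀ v, N.Internal v → 0 ≤ γ v) {a : ℕ}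
    (hI : MainInvariant N γ lo li a σ) (hb : vertexTest.holds σ) :
    ∃ T a', mainStep.Reaches σ T (MainInvariant N γ lo li a') ∧
      vertexTest.cost + 1 + T + a' ≤ a := by
  obtain ⟨X, b, hX, hR, rfl, hcase⟩ := hI
  have hc : vertexTest.cost = 3 := rfl
  have hc' : activeTest.cost = 9 := rfl
  have hi : σ.natVar 2 < n := by
    simpa [vertexTest, Test.holds, NatExpr.eval, hR.static.n_eq] using hb
  obtain ⟨u, hu⟩ : ∃ u : Fin n, σ.natVar 2 = u := ⟨⟨_, hi⟩, rfl⟩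
  have hact := hR.activeTest_iff hu
  by_cases ha : X.Active N u
  · -- walking
    -- An active vertex found by the scan is treated as a walk of length `0`.
    obtain ⟨v, hv, hvr, hkn, hbk⟩ : ∃ v, (X.nxt N)^[σ.natVar 3] v = u ∧
        (∀ j < σ.natVar 3, X.Ready N ((X.nxt N)^[j] v)) ∧ σ.natVar 3 ≤ n ∧
        (σ.natVar 3 < n → n - (σ.natVar 3 + 1) < b) := by
      rcases hcase with ⟨h1, h2, -, h4⟩ | ⟨h1, h2, h3, v, u', h4, -, h5, h6⟩
      · refine ⟨u, ?_, ?_, ?_, ?_⟩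
        · rw [h1]; rfl
        · intro j hj; omega
        · omega
        · omega
      · obtain rfl : u' = u := Fin.ext (h4.symm.trans hu)
        exact ⟨v, h5, h6, h2, by omega⟩
    by_cases hkn' : σ.natVar 3 = n
    · -- pushing round a cycle
      have hready : ∀ i, X.Ready N ((X.nxt N)^[i] u) := by
        intro i
        obtain ⟨j, hj, h⟩ := exists_iterate_eq_lt (X.nxt N) v (i + σ.natVar 3)
        rw [← hv, ← iterate_add_apply, h]
        exact hvr j (by omega)
      have hper : u ∈ periodicPts (X.nxt N) := by
        rw [← hv, hkn']
        exact iterate_mem_periodicPts (X.nxt N) v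
      have hcyc := (hR.cycleProgram_reaches hL hX hu hper hready).seq (q := StableFlow.restart)
        (T' := 4) (R := fun τ => ∃ a', MainInvariant N γ lo li a' τ ∧
          a' + 300 * (n + 1) ≤ 300 * (X.potential N * (3 * n + 3) + b)) (by
          rintro τ ⟨Y, h1, h2, h3⟩
          refine (Straight.reaches (by simp [Straight, StableFlow.restart]) ?_).mono (by decide)
            fun _ h => h
          obtain ⟨r1, r2, r3⟩ := h3.restart
          exact ⟨_, MainInvariant.restart h1 r1 r2 r3, potential_step h2⟩)
      obtain ⟨t, σ', h1, h2, a', h3, h4⟩ := hcyc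
      refine ⟨_, a', ⟨_, σ', .branch_true (hact.2 ha) (.branch_true ?_ h1), le_rfl, h3⟩, ?_⟩
      · simp [Test.holds, NatExpr.eval, hkn', hR.static.n_eq]
      · have : (natEq (.var 3) (.var 0)).cost = 3 := rfl
        omega
    · obtain ⟨Y, h1, h2, h3⟩ := hR.walkStep_post hL hγ hX hu ha
      obtain ⟨t, σ', g1, g2, rfl⟩ := walkStep_reaches (σ := σ)
      have hrun : Runs mainStep σ _ (walkStep.post σ) :=
        .branch_true (hact.2 ha) (.branch_false (by
          simpa [Test.holds, NatExpr.eval, hR.static.n_eq] using hkn') g1)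
      have hc2 : (natEq (.var 3) (.var 0)).cost = 3 := rfl
      rcases h3 with ⟨p1, p2, p3⟩ | ⟨p1, p2, p3, p4, p5, p6, p7⟩
      · refine ⟨_, _, ⟨_, _, hrun, le_rfl, MainInvariant.restart h1 h2 p2 p3⟩, ?_⟩
        have := potential_step (n := n) (c := b) p1
        omega
      · refine ⟨_, _, ⟨_, _, hrun, le_rfl, Y, n - (σ.natVar 3 + 1), h1, h2, rfl, .inr
          ⟨by omega, by omega, by rw [p6], v, X.nxt N u, p5, p7, ?_, fun j hj => ?_⟩⟩, ?_⟩
        · rw [p3, p6, iterate_succ_apply', hv]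
        · rw [p3]
          refine p4 _ ?_
          rcases Nat.lt_succ_iff_lt_or_eq.1 (p6 ▸ hj) with hj | rfl
          · exact hvr j hj
          · rwa [hv]
        · have h5 := hbk (lt_of_le_of_ne hkn hkn')
          have h6 : Y.potential N * (3 * n + 3) ≤ X.potential N * (3 * n + 3) :=
            Nat.mul_le_mul_right _ p1
          omega
  · -- scanning
    rcases hcase with ⟨h1, h2, h3, h4⟩ | ⟨-, -, -, v, u', h4, h5, -⟩
    · have hrun : Runs mainStep σ _ (σ.setNat 2 (σ.natVar 2 + 1)) :=
        .branch_false (fun h => ha (hact.1 h)) (.setNat 2 (.succ (.var 2)) σ)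
      refine ⟨_, _, ⟨_, _, hrun, le_rfl, X, 2 * n - (σ.natVar 2 + 1), hX, hR.setNat le_rfl _, rfl,
        .inl ⟨by simpa using h1, by simpa using hi, fun v hv => ?_, by simp⟩⟩, ?_⟩
      · simp only [Memory.setNat_natVar, update_self] at hv
        rcases Nat.lt_succ_iff_lt_or_eq.1 hv with hv | hv
        · exact h3 v hv
        · obtain rfl : v = u := Fin.ext (hv.trans hu)
          exact ha
      · have : (NatExpr.succ (.var 2)).cost = 2 := rfl
        omega
    · obtain rfl : u' = u := Fin.ext (h4.symm.trans hu)
      exact absurd h5 ha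

/-! ### Initialization -/

open Classical in
/-- Initially the edges leaving the sources are saturated. -/
noncomputable def initialFlow (N : Network (Fin n) (Fin m)) (e : Fin m) : ℝ :=
  if N.tail e ∈ N.S then N.c e else 0

/-- The state with which the main loop starts; at the terminals, the surpluses are arbitrary. -/
noncomputable def initialState (N : Network (Fin n) (Fin m)) (lo li : Fin n → List (Fin m))
    (s₀ : Fin n → ℝ) : State n m where
  f := initialFlow N
  r e := N.c e - initialFlow N e
  s v := s₀ v + ∑ e, if N.head e = v then initialFlow N e else 0
  out := lo
  inn v := (li v).reverse

/-- At the start `f + r = c` everywhere and no list has been shortened. Edges leaving internal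
vertices are empty, so the excess of such a vertex is its inflow. -/
theorem initialState_valid (hL : Lists N lo li) {s₀ : Fin n → ℝ}
    (hs : ∀ v, N.Internal v → s₀ v = if lo v = [] then - γ v else 0) :
    (initialState N lo li s₀).Valid N γ lo li := by
  have hf : ∀ e, 0 ≤ initialFlow N e ∧ initialFlow N e ≤ N.c e := by
    intro e
    unfold initialFlow
    split_ifs
    exacts [⟨N.c_nonneg e, le_rfl⟩, ⟨le_rfl, N.c_nonneg e⟩]
  refine ⟨⟨fun e => (hf e).1, fun e => sub_nonneg.2 (hf e).2, fun e => ?_, fun v => List.suffix_rfl,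
    fun v => List.suffix_rfl, fun e he => ?_, fun e _ he => ?_, fun e _ he => ?_, fun e he => ?_,
    fun v p t hv hvt e he => ?_⟩, fun v hv => ?_⟩
  · simp [initialState]
  · simp [initialState] at he
  · exact absurd (List.mem_reverse.2 (((hL.inn _).2.1 e).2 rfl)) he
  · exact absurd (((hL.out _).2.1 e).2 rfl) he
  · simp [initialState, initialFlow, he]
  · have : N.tail e = v := ((hL.out v).2.1 e).1
      ((show lo v = p :: t from hvt) ▸ List.mem_cons_of_mem _ he)
    have h2 : N.tail e ∉ N.S := this ▸ hv.1
    simp [initialState, initialFlow, h2]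
  · have h1 : N.excess (initialFlow N) v = ∑ e, if N.head e = v then initialFlow N e else 0 := by
      rw [N.excess_eq_sum]
      refine Finset.sum_congr rfl fun e _ => ?_
      by_cases he : N.tail e = v
      · have h2 : N.tail e ∉ N.S := he ▸ hv.1
        simp [initialFlow, h2]
      · simp [he]
    simp only [initialState, State.threshold]
    constructor
    · rw [h1, hs v hv]
      by_cases hl : lo v = [] <;> simp [hl]
    · rw [h1]
      refine Finset.sum_nonneg fun e _ => ?_
      split_ifs
      exacts [(hf e).1, le_rfl]

theorem sum_length_eq {l : Fin n → List (Fin m)} {endpt : Fin m → Fin n}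
    (h : ∀ v, (l v).Nodup ∧ ∀ e, e ∈ l v ↔ endpt e = v) : ∑ v, (l v).length = m := by
  classical
  have h1 : ∀ v, (l v).length = (Finset.univ.filter (fun e => endpt e = v)).card := by
    intro v
    rw [← List.toFinset_card_of_nodup (h v).1]
    congr 1
    ext e
    simp [(h v).2]
  simp_rw [h1]
  rw [← Finset.card_eq_sum_card_fiberwise (fun e _ => Finset.mem_univ (endpt e))]
  simp

/-- The two families of lists contribute at most `m` each and the edges `4 * m`. Active vertices
have positive excess, so they are heads of edges and number at most `m`; a bound by `n` would not do
when there are many isolated vertices. -/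
theorem potential_le (hL : Lists N lo li) (hγ : ∀ v, N.Internal v → 0 ≤ γ v)
    (hX : X.Valid N γ lo li) : X.potential N ≤ 7 * m := by
  classical
  have h1 : ∑ v, (X.out v).length ≤ m :=
    (Finset.sum_le_sum fun v _ => (hX.core.out_suffix v).length_le).trans
      (sum_length_eq fun v => ⟨(hL.out v).1, (hL.out v).2.1⟩).le
  have h2 : ∑ v, (X.inn v).length ≤ m :=
    (Finset.sum_le_sum fun v _ => by simpa using (hX.core.inn_suffix v).length_le).trans
      (sum_length_eq fun v => ⟨(hL.inn v).1, (hL.inn v).2.1⟩).le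
  have h3 : ∑ e, X.edgePotential e ≤ ∑ _e : Fin m, 2 :=
    Finset.sum_le_sum fun e _ => by unfold State.edgePotential; split_ifs <;> omega
  have h4 : X.activeSet N ⊆ Finset.univ.image N.head := by
    intro v hv
    have ha := State.mem_activeSet.1 hv
    by_contra hn
    have h5 : N.excess X.f v ≤ 0 := by
      rw [N.excess_eq_sum]
      refine Finset.sum_nonpos fun e _ => ?_
      rw [if_neg (fun h => hn (Finset.mem_image.2 ⟨e, Finset.mem_univ e, h⟩))]
      have := hX.core.f_nonneg e
      split_ifs <;> linarith
    have h6 := (hX.balanced v ha.1).1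
    have h7 : 0 ≤ X.threshold γ v := by
      unfold State.threshold
      split_ifs
      exacts [hγ v ha.1, le_rfl]
    linarith [ha.2]
  have h5 := (Finset.card_le_card h4).trans Finset.card_image_le
  simp only [Finset.sum_const, Finset.card_univ, Fintype.card_fin, smul_eq_mul] at h3 h5
  unfold State.potential
  omega

theorem initVertex_reaches :
    initVertex.Reaches σ 50 (fun τ => τ = initVertex.post σ) :=
  (Straight.reaches (by simp [Straight, initVertex]) rfl).mono (by decide) fun _ h => h.symm

theorem initEdge_reaches :
    initEdge.Reaches σ 50 (fun τ => τ = initEdge.post σ) :=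
  (Straight.reaches (by simp [Straight, initEdge]) rfl).mono (by decide) fun _ h => h.symm

/-- The values with which the surpluses are initialized. -/
noncomputable def initialSurplus (σ : Memory) (v : ℕ) : ℝ :=
  if σ.natArr 3 v = σ.natVar 1 then 0 - σ.realArr 1 v else 0

/-- `τ` differs from `σ` only in the variable `2` and in the real arrays `0`, `2` and `3`. -/
structure Frame (σ τ : Memory) : Prop where
  natVar : ∀ x, x ≠ 2 → τ.natVar x = σ.natVar x
  natArr : τ.natArr = σ.natArr
  realArr : τ.realArr 1 = σ.realArr 1

theorem initVertex_post (hF : Frame σ τ) : Frame σ (initVertex.post τ) ∧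
    (initVertex.post τ).natVar 2 = τ.natVar 2 + 1 ∧
    (initVertex.post τ).realArr 0 = τ.realArr 0 ∧
    (initVertex.post τ).realArr 3 =
      update (τ.realArr 3) (τ.natVar 2) (initialSurplus σ (τ.natVar 2)) := by
  have h1 : exhaustedTest.holds τ ↔ σ.natArr 3 (τ.natVar 2) = σ.natVar 1 := by
    simp only [exhaustedTest, Test.holds, NatExpr.eval, hF.natArr, hF.natVar 1 (by norm_num)]
  rw [initVertex, Program.post]
  by_cases h : exhaustedTest.holds τ
  · rw [post_branch_pos h]
    refine ⟨⟨fun x hx => ?_, ?_, ?_⟩, ?_, ?_, ?_⟩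
    · simpa [Program.post, NatExpr.eval, hx] using hF.natVar x hx
    · simpa [Program.post] using hF.natArr
    · simpa [Program.post] using hF.realArr
    · simp [Program.post, NatExpr.eval]
    · simp [Program.post]
    · simp [Program.post, NatExpr.eval, RealExpr.eval, initialSurplus, h1.1 h, hF.realArr]
  · rw [post_branch_neg h]
    refine ⟨⟨fun x hx => ?_, ?_, ?_⟩, ?_, ?_, ?_⟩
    · simpa [Program.post, NatExpr.eval, hx] using hF.natVar x hx
    · simpa [Program.post] using hF.natArr
    · simpa [Program.post] using hF.realArr
    · simp [Program.post, NatExpr.eval]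
    · simp [Program.post]
    · simp [Program.post, NatExpr.eval, RealExpr.eval, initialSurplus, h1.not.1 h]

theorem initVertices_reaches (hn : σ.natVar 0 = n) :
    (Program.seq (.setNat 2 (.const 0)) (.loop vertexTest initVertex)).Reaches σ (60 * n + 10)
      (fun τ => Frame σ τ ∧ τ.realArr 0 = σ.realArr 0 ∧
        ∀ v < n, τ.realArr 3 v = initialSurplus σ v) := by
  let I (a : ℕ) (τ : Memory) : Prop := Frame σ τ ∧ τ.realArr 0 = σ.realArr 0 ∧ τ.natVar 2 ≤ n ∧
    (∀ v < τ.natVar 2, τ.realArr 3 v = initialSurplus σ v) ∧ a = 60 * (n - τ.natVar 2)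
  have hc : vertexTest.cost = 3 := rfl
  have htest : ∀ τ, Frame σ τ → (vertexTest.holds τ ↔ τ.natVar 2 < n) := by
    intro τ hF
    simp only [vertexTest, Test.holds, NatExpr.eval, hF.natVar 0 (by norm_num), hn]
  have hstep : ∀ a τ, I a τ → vertexTest.holds τ →
      ∃ T a', initVertex.Reaches τ T (I a') ∧ vertexTest.cost + 1 + T + a' ≤ a := by
    rintro a τ ⟨h1, h2, h3, h4, rfl⟩ hb
    have hi := (htest τ h1).1 hb
    refine ⟨50, 60 * (n - (τ.natVar 2 + 1)), initVertex_reaches.mono le_rfl ?_, by omega⟩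
    rintro _ rfl
    obtain ⟨k1, k2, k3, k4⟩ := initVertex_post h1
    refine ⟨k1, k3.trans h2, k2 ▸ hi, fun v hv => ?_, by rw [k2]⟩
    rw [k4]
    by_cases hv' : v = τ.natVar 2
    · simp [hv']
    · rw [update_of_ne hv']
      exact h4 v (by omega)
  have hinit : (Program.setNat 2 (.const 0)).Reaches σ 2 (I (60 * n)) := by
    refine ⟨_, _, .setNat 2 (.const 0) σ, le_rfl, ⟨fun x hx => ?_, rfl, rfl⟩, rfl, ?_, fun v hv => ?_,
      ?_⟩
    · simp [hx]
    · simp [NatExpr.eval]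
    · simp [NatExpr.eval] at hv
    · simp [NatExpr.eval]
  refine (hinit.seq fun τ hτ => (reaches_loop hstep hτ).mono le_rfl ?_).mono (by omega) fun _ h => h
  rintro τ' ⟨hb, a', h1, h2, h3, h4, -⟩
  have := (htest τ' h1).not.1 hb
  exact ⟨h1, h2, fun v hv => h4 v (by omega)⟩

/-- The state of the arrays after `j` rounds of the second loop. -/
structure EdgeInvariant (N : Network (Fin n) (Fin m)) (s₀ : ℕ → ℝ) (j : ℕ) (τ : Memory) :
    Prop where
  -- Array `2` holds arbitrary values at first, so nothing is claimed beyond index `j`.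
  f : ∀ e : Fin m, e < j → τ.realArr 2 e = initialFlow N e
  r : ∀ e : Fin m, τ.realArr 0 e = if (e : ℕ) < j then N.c e - initialFlow N e else N.c e
  s : ∀ v : Fin n, τ.realArr 3 v =
    s₀ v + ∑ e : Fin m, if (e : ℕ) < j ∧ N.head e = v then initialFlow N e else 0

theorem sum_lt_succ (g : Fin m → ℝ) (P : Fin m → Prop) [DecidablePred P] (e₀ : Fin m) :
    (∑ e : Fin m, if (e : ℕ) < (e₀ : ℕ) + 1 ∧ P e then g e else 0) =
      (∑ e : Fin m, if (e : ℕ) < e₀ ∧ P e then g e else 0) + if P e₀ then g e₀ else 0 := by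
  have h : (if P e₀ then g e₀ else 0) = ∑ e, if e = e₀ then (if P e then g e else 0) else 0 := by
    rw [Finset.sum_ite_eq']; simp
  rw [h, ← Finset.sum_add_distrib]
  refine Finset.sum_congr rfl fun e _ => ?_
  rcases lt_trichotomy e e₀ with h | rfl | h
  · have h1 : (e : ℕ) < (e₀ : ℕ) + 1 := Nat.lt_succ_of_lt h
    have h2 : (e : ℕ) < e₀ := h
    simp [h1, h2, h.ne]
  · simp
  · have h1 : ¬ (e : ℕ) < (e₀ : ℕ) + 1 := by have : (e₀ : ℕ) < e := h; omega
    have h2 : ¬ (e : ℕ) < e₀ := by have : (e₀ : ℕ) < e := h; omega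
    simp [h1, h2, h.ne']

theorem initEdge_post {s₀ : ℕ → ℝ} (hS : Static N γ lo li σ) (hF : Frame σ τ)
    (hj : τ.natVar 2 = e) (hI : EdgeInvariant N s₀ e τ) :
    Frame σ (initEdge.post τ) ∧ (initEdge.post τ).natVar 2 = e + 1 ∧
      EdgeInvariant N s₀ (e + 1) (initEdge.post τ) := by
  have htest : (natEq (.get 0 (.get 1 (.var 2))) (.const 1)).holds τ ↔ N.tail e ∈ N.S := by
    simp only [Test.holds, NatExpr.eval, hj, hF.natArr, hS.tail, hS.source]
  have hr : τ.realArr 0 e = N.c e := by rw [hI.r]; simp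
  have hlt : ∀ e' : Fin m, (e' : ℕ) < e + 1 → e' ≠ e → (e' : ℕ) < e := by
    intro e' h h'
    have := Fin.val_ne_of_ne h'
    omega
  have hiff : ∀ e' : Fin m, e' ≠ e → ((e' : ℕ) < e + 1 ↔ (e' : ℕ) < e) := fun e' h =>
    ⟨fun h' => hlt e' h' h, fun h' => by omega⟩
  rw [initEdge, Program.post]
  by_cases h : N.tail e ∈ N.S
  · have hf0 : initialFlow N e = N.c e := by simp [initialFlow, h]
    rw [post_branch_pos (htest.2 h)]
    refine ⟨⟨fun x hx => ?_, ?_, ?_⟩, ?_, ⟨fun e' he' => ?_, fun e' => ?_, fun v => ?_⟩⟩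
    · simpa [Program.post, NatExpr.eval, hx] using hF.natVar x hx
    · simpa [Program.post] using hF.natArr
    · simpa [Program.post] using hF.realArr
    · simp [Program.post, NatExpr.eval, hj]
    · by_cases hee : e' = e
      · subst hee
        simp [Program.post, NatExpr.eval, RealExpr.eval, hj, hr, hf0]
      · simpa [Program.post, NatExpr.eval, RealExpr.eval, hj, Fin.val_ne_of_ne hee] using
          hI.f e' (hlt e' he' hee)
    · by_cases hee : e' = e
      · subst hee
        simp [Program.post, NatExpr.eval, RealExpr.eval, hj, hf0]
      · simpa [Program.post, NatExpr.eval, RealExpr.eval, hj, Fin.val_ne_of_ne hee, hiff e' hee]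
          using hI.r e'
    · rw [sum_lt_succ, ← add_assoc, ← hI.s]
      by_cases hv : v = N.head e
      · subst hv
        simp [Program.post, NatExpr.eval, RealExpr.eval, hj, hF.natArr, hS.head, hr, hf0]
      · simp [Program.post, NatExpr.eval, RealExpr.eval, hj, hF.natArr, hS.head,
          Fin.val_ne_of_ne hv, Ne.symm hv]
  · have hf0 : initialFlow N e = 0 := by simp [initialFlow, h]
    rw [post_branch_neg (htest.not.2 h)]
    refine ⟨⟨fun x hx => ?_, ?_, ?_⟩, ?_, ⟨fun e' he' => ?_, fun e' => ?_, fun v => ?_⟩⟩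
    · simpa [Program.post, NatExpr.eval, hx] using hF.natVar x hx
    · simpa [Program.post] using hF.natArr
    · simpa [Program.post] using hF.realArr
    · simp [Program.post, NatExpr.eval, hj]
    · by_cases hee : e' = e
      · subst hee
        simp [Program.post, NatExpr.eval, RealExpr.eval, hj, hf0]
      · simpa [Program.post, NatExpr.eval, RealExpr.eval, hj, Fin.val_ne_of_ne hee] using
          hI.f e' (hlt e' he' hee)
    · by_cases hee : e' = e
      · subst hee
        simp [Program.post, hf0, hr]
      · simpa [Program.post, hiff e' hee] using hI.r e'
    · rw [sum_lt_succ, ← add_assoc, ← hI.s]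
      simp [Program.post, hf0]

theorem initEdges_reaches {s₀ : ℕ → ℝ} (hS : Static N γ lo li σ) (hF : Frame σ τ)
    (hI : EdgeInvariant N s₀ 0 τ) :
    (Program.seq (.setNat 2 (.const 0)) (.loop edgeTest initEdge)).Reaches τ (60 * m + 10)
      (fun τ => Frame σ τ ∧ EdgeInvariant N s₀ m τ) := by
  let I (a : ℕ) (τ : Memory) : Prop := Frame σ τ ∧ τ.natVar 2 ≤ m ∧
    EdgeInvariant N s₀ (τ.natVar 2) τ ∧ a = 60 * (m - τ.natVar 2)
  have hc : edgeTest.cost = 3 := rfl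
  have htest : ∀ τ, Frame σ τ → (edgeTest.holds τ ↔ τ.natVar 2 < m) := by
    intro τ hF
    simp only [edgeTest, Test.holds, NatExpr.eval, hF.natVar 1 (by norm_num), hS.m_eq]
  have hstep : ∀ a τ, I a τ → edgeTest.holds τ →
      ∃ T a', initEdge.Reaches τ T (I a') ∧ edgeTest.cost + 1 + T + a' ≤ a := by
    rintro a τ ⟨h1, h2, h3, rfl⟩ hb
    have hi := (htest τ h1).1 hb
    refine ⟨50, 60 * (m - (τ.natVar 2 + 1)), initEdge_reaches.mono le_rfl ?_, by omega⟩
    rintro _ rfl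
    obtain ⟨k1, k2, k3⟩ := initEdge_post (e := ⟨τ.natVar 2, hi⟩) hS h1 rfl h3
    simp only at k2 k3
    exact ⟨k1, k2 ▸ hi, k2 ▸ k3, by rw [k2]⟩
  have hinit : (Program.setNat 2 (.const 0)).Reaches τ 2 (I (60 * m)) := by
    refine ⟨_, _, .setNat 2 (.const 0) τ, le_rfl, ⟨fun x hx => ?_, hF.natArr, hF.realArr⟩, ?_, ?_, ?_⟩
    · simpa [hx] using hF.natVar x hx
    · simp [NatExpr.eval]
    · simp only [NatExpr.eval, Memory.setNat_natVar, update_self]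
      exact ⟨hI.f, hI.r, hI.s⟩
    · simp [NatExpr.eval]
  refine (hinit.seq fun τ hτ => (reaches_loop hstep hτ).mono le_rfl ?_).mono (by omega) fun _ h => h
  rintro τ' ⟨hb, a', h1, h2, h3, -⟩
  have := (htest τ' h1).not.1 hb
  obtain h4 : τ'.natVar 2 = m := by omega
  exact ⟨h1, h4 ▸ h3⟩

theorem initProgram_reaches (hL : Lists N lo li) (hS : Static N γ lo li σ)
    (ho : ∀ v : Fin n, σ.natArr 3 v = edgeRef (lo v).head?)
    (hi : ∀ v : Fin n, σ.natArr 8 v = edgeRef (li v).reverse.head?)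
    (hc : ∀ e : Fin m, σ.realArr 0 e = N.c e) :
    initProgram.Reaches σ (60 * n + 60 * m + 20) (fun τ => ∃ X : State n m,
      X.Valid N γ lo li ∧ Rep N γ lo li τ X) := by
  refine ((initVertices_reaches hS.n_eq).seq (T' := 60 * m + 10) (R := fun τ => ∃ X : State n m,
      X.Valid N γ lo li ∧ Rep N γ lo li τ X) ?_).mono (by omega) fun _ h => h
  rintro τ ⟨hF, h0, h3⟩
  refine (initEdges_reaches (s₀ := initialSurplus σ) hS hF ⟨fun e he => ?_, fun e => ?_,
    fun v => ?_⟩).mono le_rfl ?_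
  · omega
  · simp [h0, hc]
  · simp [h3 v v.2]
  · rintro ρ ⟨hF', hI⟩
    refine ⟨initialState N lo li fun v => initialSurplus σ v, initialState_valid hL fun v hv => ?_,
      hS.congr (hF'.natVar 0 (by norm_num)) (hF'.natVar 1 (by norm_num))
        (fun a _ _ => by rw [hF'.natArr]) hF'.realArr, fun e => ?_, fun e => ?_, fun v => ?_,
      fun v => ?_, fun v => ?_⟩
    · simp only [initialSurplus, ho, hS.m_eq, edgeRef_head?_eq_iff, hS.gamma v hv, zero_sub]
    · exact hI.f e e.2
    · rw [hI.r]; simp [initialState]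
    · rw [hI.s]; simp [initialState]
    · rw [hF'.natArr, ho]; rfl
    · rw [hF'.natArr, hi]; rfl

/-- The program finds a stable `γ`-preflow in time `O(nm)`. -/
theorem stableFlowProgram_reaches (hγ : ∀ v, N.Internal v → 0 ≤ γ v) (hσ : HoldsInput N γ σ) :
    stableFlowProgram.Reaches σ (20000 * (n * m + 1))
      (fun τ => N.IsStableGammaPreflow γ (output m τ)) := by
  obtain ⟨lo, li, hL, hS, ho, hi, hc⟩ := hσ.static
  have htest : (natEq (.var 1) (.const 0)).holds σ ↔ m = 0 := by
    simp only [Test.holds, NatExpr.eval, hS.m_eq]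
  -- Initialization takes time proportional to `n + m`, which is `O(nm)` only if there is an edge.
  -- Without edges there is nothing to write.
  rcases Nat.eq_zero_or_pos m with hm | hm
  · refine ⟨_, _, .branch_true (htest.2 hm) (.skip σ), ?_, ?_⟩
    · have : (natEq (.var 1) (.const 0)).cost = 3 := rfl
      omega
    · subst hm
      refine ⟨⟨⟨fun e => e.elim0, fun v _ => ?_⟩, fun v hv => ?_⟩, fun P hP => ?_⟩
      · simp [N.excess_eq_sum]
      · simpa [N.excess_eq_sum] using hγ v hv
      · exact (P.head hP).elim0
  · have hn : 0 < n := (N.tail ⟨0, hm⟩).pos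
    have hmain := (initProgram_reaches hL hS ho hi hc).seq
      (q := .seq restart (.loop vertexTest mainStep))
      (T' := 4 + (300 * (7 * m * (3 * n + 3) + 2 * n) + 3 + 1))
      (R := fun τ => N.IsStableGammaPreflow γ (output m τ)) (by
        rintro τ ⟨X, hX, hR⟩
        have hrestart : restart.Reaches τ 4 (fun ρ => ρ = restart.post τ) :=
          (Straight.reaches (by simp [Straight, restart]) rfl).mono (by decide) fun _ h => h.symm
        refine hrestart.seq ?_
        rintro _ rfl
        obtain ⟨r1, r2, r3⟩ := hR.restart
        have hp : X.potential N * (3 * n + 3) ≤ 7 * m * (3 * n + 3) :=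
          Nat.mul_le_mul_right _ (potential_le hL hγ hX)
        have hcost : vertexTest.cost = 3 := rfl
        refine (reaches_loop (fun a σ h hb => mainStep_reaches hL hγ h hb)
          (MainInvariant.restart hX r1 r2 r3)).mono (by omega) ?_
        rintro ρ ⟨hb, a, Y, b, hY, hRY, -, hcase⟩
        have hi : ¬ ρ.natVar 2 < n := by
          simpa [vertexTest, Test.holds, NatExpr.eval, hRY.static.n_eq] using hb
        have hout : output m ρ = Y.f := funext fun e => hRY.f e
        rw [hout]
        rcases hcase with ⟨-, h2, h3, -⟩ | ⟨-, -, -, v, u, h4, -⟩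
        · exact hY.core.isStable hL hY.balanced (fun v => h3 v (by omega)) hγ
        · omega)
    obtain ⟨t, τ, h1, h2, h3⟩ := hmain
    refine ⟨_, τ, .branch_false (htest.not.2 hm.ne') h1, ?_, h3⟩
    have : (natEq (.var 1) (.const 0)).cost = 3 := rfl
    -- With `1 ≤ n` and `1 ≤ m`, each of `n`, `m` and `1` is at most `n * m`, so all terms are
    -- absorbed.
    nlinarith [Nat.mul_le_mul hn hm, Nat.le_mul_of_pos_left m hn, Nat.le_mul_of_pos_right n hm]

/-! ### Existence -/

theorem exists_pairwise_list {α : Type*} [Fintype α] (lt : α → α → Prop)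
    (h : IsStrictTotalOrder α lt) : ∃ l : List α, l.Nodup ∧ (∀ a, a ∈ l) ∧ l.Pairwise lt := by
  classical
  let _ : LinearOrder α := linearOrderOfSTO lt
  refine ⟨(Finset.univ : Finset α).sort (· ≤ ·), Finset.sort_nodup _ _, by simp, ?_⟩
  exact (Finset.sortedLT_sort _).pairwise

theorem exists_listsEdges (N : Network (Fin n) (Fin m)) (endpt : Fin m → Fin n)
    (lt : Fin m → Fin m → Prop) (h : ∀ v, v ∉ N.S → v ∉ N.T →
      IsStrictTotalOrder {e : Fin m // endpt e = v} (fun a b => lt a.1 b.1)) :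
    ∃ l, ListsEdges N endpt lt l := by
  classical
  have key : ∀ v, ∃ l : List (Fin m), l.Nodup ∧ (∀ e, e ∈ l ↔ endpt e = v) ∧
      (N.Internal v → l.Pairwise lt) := by
    intro v
    by_cases hv : N.Internal v
    · obtain ⟨l, h1, h2, h3⟩ := exists_pairwise_list _ (h v hv.1 hv.2)
      refine ⟨l.map Subtype.val, h1.map Subtype.val_injective, fun e => ?_, fun _ => ?_⟩
      · simp [h2]
      · exact List.pairwise_map.2 h3
    · refine ⟨(Finset.univ.filter fun e => endpt e = v).toList, Finset.nodup_toList _, by simp,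
        fun h => absurd h hv⟩
  choose l hl using key
  exact ⟨l, hl⟩

/-- An edge occurs in only one list, that of its endpoint, and once there; its index determines both
neighbours. -/
theorem exists_linkedLists (l : Fin n → List (Fin m)) (endpt : Fin m → Fin n)
    (hn : ∀ v, (l v).Nodup) (hl : ∀ v, ∀ e ∈ l v, endpt e = v) :
    ∃ first last next prev, LinkedLists l first last next prev := by
  refine ⟨fun i => if h : i < n then edgeRef (l ⟨i, h⟩).head? else 0,
    fun i => if h : i < n then edgeRef (l ⟨i, h⟩).getLast? else 0,
    fun i => if h : i < m then
      edgeRef (l (endpt ⟨i, h⟩))[(l (endpt ⟨i, h⟩)).idxOf ⟨i, h⟩ + 1]? else 0,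
    fun i => if h : i < m then
      edgeRef (if (l (endpt ⟨i, h⟩)).idxOf ⟨i, h⟩ = 0 then none
        else (l (endpt ⟨i, h⟩))[(l (endpt ⟨i, h⟩)).idxOf ⟨i, h⟩ - 1]?) else 0,
    fun v => ⟨by simp, by simp, fun i hi => ?_⟩⟩
  have h1 : endpt (l v)[i] = v := hl v _ (List.getElem_mem hi)
  have h2 : (l v).idxOf (l v)[i] = i := (hn v).idxOf_getElem i hi
  simp [h1, h2]

/-- Every numbered network can be stored in a memory, so correctness of the program implies
existence. -/
theorem exists_holdsInput (N : Network (Fin n) (Fin m)) (γ : Fin n → ℝ) :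
    ∃ σ, HoldsInput N γ σ := by
  classical
  obtain ⟨lo, hlo⟩ := exists_listsEdges N N.tail N.outLt N.out_order
  obtain ⟨li, hli⟩ := exists_listsEdges N N.head N.inLt N.in_order
  obtain ⟨a3, a4, a5, a6, ho⟩ := exists_linkedLists lo N.tail (fun v => (hlo v).1)
    fun v e => ((hlo v).2.1 e).1
  obtain ⟨a7, a8, a9, a10, hi⟩ := exists_linkedLists li N.head (fun v => (hli v).1)
    fun v e => ((hli v).2.1 e).1
  let type (i : ℕ) : ℕ := if h : i < n then
    (if (⟨i, h⟩ : Fin n) ∈ N.S then 1 else if (⟨i, h⟩ : Fin n) ∈ N.T then 2 else 0) else 0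
  let onEdges (g : Fin m → ℕ) (i : ℕ) : ℕ := if h : i < m then g ⟨i, h⟩ else 0
  refine ⟨⟨fun x => if x = 0 then n else m, fun a => match a with
      | 0 => type
      | 1 => onEdges fun e => N.tail e
      | 2 => onEdges fun e => N.head e
      | 3 => a3 | 4 => a4 | 5 => a5 | 6 => a6 | 7 => a7 | 8 => a8 | 9 => a9 | 10 => a10
      | _ => fun _ => 0,
    fun _ => 0, fun a i => if a = 0 then (if h : i < m then N.c ⟨i, h⟩ else 0) else
      (if h : i < n then γ ⟨i, h⟩ else 0)⟩, rfl, rfl, fun v => ⟨fun h => ?_, fun h => ?_, fun h => ?_⟩,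
    fun e => ?_, ⟨lo, hlo, ho⟩, ⟨li, hli, hi⟩, fun e => ?_, fun v _ => ?_⟩
  · simp [type, h.1, h.2]
  · simp [type, h]
  · have : v ∉ N.S := fun h' => Set.disjoint_left.1 N.disjoint h' h
    simp [type, h, this]
  · simp [onEdges]
  · simp
  · simp

/-! ### Transfer to arbitrary finite vertex and edge sets -/

namespace Network

variable {V E V' E' : Type*}

/-- The copy of a network under renaming of the vertices and edges. -/
def rename (N : Network V E) (a : V ≃ V') (b : E ≃ E') : Network V' E' where
  tail e := a (N.tail (b.symm e))
  head e := a (N.head (b.symm e))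
  loopless e h := N.loopless _ (a.injective h)
  simple e e' h h' := b.symm.injective (N.simple _ _ (a.injective h) (a.injective h'))
  S := a.symm ⁻¹' N.S
  T := a.symm ⁻¹' N.T
  disjoint := N.disjoint.preimage _
  no_in_source e h := N.no_in_source (b.symm e) (by simpa using h)
  no_out_sink e h := N.no_out_sink (b.symm e) (by simpa using h)
  c e := N.c (b.symm e)
  c_nonneg e := N.c_nonneg _
  outLt e e' := N.outLt (b.symm e) (b.symm e')
  inLt e e' := N.inLt (b.symm e) (b.symm e')
  out_order v hS hT := by
    have h := N.out_order (a.symm v) hS hT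
    let φ : {e : E' // a (N.tail (b.symm e)) = v} → {e : E // N.tail e = a.symm v} :=
      fun e => ⟨b.symm e.1, a.injective (e.2.trans (a.apply_symm_apply v).symm)⟩
    have hφ : Injective φ := fun x y hxy => by
      simpa [φ, Subtype.ext_iff] using hxy
    exact (RelEmbedding.mk ⟨φ, hφ⟩ Iff.rfl :
      (fun x y : {e : E' // a (N.tail (b.symm e)) = v} =>
        N.outLt (b.symm x.1) (b.symm y.1)) ↪r
      (fun x y : {e : E // N.tail e = a.symm v} => N.outLt x.1 y.1)).isStrictTotalOrder
  in_order v hS hT := by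
    have h := N.in_order (a.symm v) hS hT
    let φ : {e : E' // a (N.head (b.symm e)) = v} → {e : E // N.head e = a.symm v} :=
      fun e => ⟨b.symm e.1, a.injective (e.2.trans (a.apply_symm_apply v).symm)⟩
    have hφ : Injective φ := fun x y hxy => by
      simpa [φ, Subtype.ext_iff] using hxy
    exact (RelEmbedding.mk ⟨φ, hφ⟩ Iff.rfl :
      (fun x y : {e : E' // a (N.head (b.symm e)) = v} =>
        N.inLt (b.symm x.1) (b.symm y.1)) ↪r
      (fun x y : {e : E // N.head e = a.symm v} => N.inLt x.1 y.1)).isStrictTotalOrder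

variable {N : Network V E} {a : V ≃ V'} {b : E ≃ E'} {γ : V' → ℝ} {f : E' → ℝ}

theorem rename_internal {v : V} : (N.rename a b).Internal (a v) ↔ N.Internal v := by
  simp [Internal, rename]

theorem rename_excess [Fintype E] [Fintype E'] (v : V) :
    (N.rename a b).excess f (a v) = N.excess (f ∘ b) v := by
  classical
  unfold excess
  congr 1
  · refine (Finset.sum_bij (fun e _ => b e) ?_ ?_ ?_ ?_).symm
    · simp [rename]
    · simp
    · intro e he
      exact ⟨b.symm e, by simpa [rename] using he, by simp⟩
    · simp
  · refine (Finset.sum_bij (fun e _ => b e) ?_ ?_ ?_ ?_).symm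
    · simp [rename]
    · simp
    · intro e he
      exact ⟨b.symm e, by simpa [rename] using he, by simp⟩
    · simp

theorem IsStableGammaPreflow.of_rename [Fintype E] [Fintype E']
    (h : (N.rename a b).IsStableGammaPreflow γ f) :
    N.IsStableGammaPreflow (γ ∘ a) (f ∘ b) := by
  obtain ⟨⟨⟨h1, h2⟩, h3⟩, h4⟩ := h
  refine ⟨⟨⟨fun e => ?_, fun v hv => ?_⟩, fun v hv => ?_⟩, fun P hP hdir hun => ?_⟩
  · simpa [rename] using h1 (b e)
  · rw [← rename_excess (a := a)]
    exact h2 (a v) (by simpa [rename] using hv)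
  · rw [← rename_excess (a := a)]
    exact h3 (a v) (rename_internal.2 hv)
  · have h5 := h4 (P.map b) (by simpa using hP) ?_ ?_
    · refine h5.imp (fun h => ?_) fun h => ?_
      · rw [List.getLast_map] at h
        obtain ⟨g1, g2⟩ := h
        refine ⟨?_, fun e he hlt => ?_⟩
        · simpa [Internal, rename] using g1
        · exact g2 (b e) (by simpa [rename] using he) (by simpa [rename] using hlt)
      · rw [List.head_map] at h
        obtain ⟨⟨g1, g2⟩, g3⟩ := h
        refine ⟨⟨?_, fun e he hlt => ?_⟩, ?_⟩
        · simpa [Internal, rename] using g1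
        · exact g2 (b e) (by simpa [rename] using he) (by simpa [rename] using hlt)
        · rw [← rename_excess (a := a)]
          simpa [rename] using g3
    · unfold IsDirectedPath at hdir ⊢
      rw [List.isChain_map]
      simpa [rename] using hdir
    · intro e he
      obtain ⟨e', he', rfl⟩ := List.mem_map.1 he
      simpa [rename] using hun e' he'

end Network

theorem exists_isStableGammaPreflow {V E : Type*} [Fintype V] [Fintype E] (N : Network V E)
    (γ : V → ℝ) (hγ : ∀ v, N.Internal v → 0 ≤ γ v) : ∃ f, N.IsStableGammaPreflow γ f := by
  let a := Fintype.equivFin V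
  let b := Fintype.equivFin E
  obtain ⟨σ, hσ⟩ := exists_holdsInput (N.rename a b) (γ ∘ a.symm)
  obtain ⟨-, τ, -, -, h⟩ := stableFlowProgram_reaches (fun v hv => by
    obtain ⟨w, rfl⟩ := a.surjective v
    simpa using hγ w (Network.rename_internal.1 hv)) hσ
  have h' := h.of_rename
  exact ⟨_, by simpa [Function.comp_assoc] using h'⟩

end StableFlow
theorem mainTheorem3 :
    -- existence
    (∀ (V E : Type*) [Fintype V] [Fintype E] (N : StableFlow.Network V E) (γ : V → ℝ),
      (∀ v, N.Internal v → 0 ≤ γ v) → ∃ f : E → ℝ, N.IsStableGammaPreflow γ f) ∧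
    -- one program finds a stable `γ`-preflow in every network in time `O(nm)`
    (∃ (p : StableFlow.Program) (C : ℕ),
      ∀ (n m : ℕ) (N : StableFlow.Network (Fin n) (Fin m)) (γ : Fin n → ℝ),
        (∀ v, N.Internal v → 0 ≤ γ v) →
        ∀ σ : StableFlow.Memory, StableFlow.HoldsInput N γ σ →
          ∃ (t : ℕ) (σ' : StableFlow.Memory), StableFlow.Runs p σ t σ' ∧
            t ≤ C * (n * m + 1) ∧
            N.IsStableGammaPreflow γ (StableFlow.output m σ')) :=
  ⟨fun _ _ _ _ N γ hγ => StableFlow.exists_isStableGammaPreflow N γ hγ,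
    StableFlow.stableFlowProgram, 20000, fun _ _ _ _ hγ _ hσ =>
      StableFlow.stableFlowProgram_reaches hγ hσ⟩
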